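/- Let $E$ be a finite set, $r(a,b)\ge 0$ ($a\neq b$) the transition rates of a continuous-time Markov chain on $E$ with generator $Qf(a)=\sum_b r(a,b)(f_b-f_a)$, and $\mu$ a probability measure on $E$. For $x\in E^N$ let $M_N(x)=\frac1N\sum_{i=1}^N\delta_{x_i}$, and let $\mathcal Q_N=\sum_{i=1}^N Q_i$ be the generator of $N$ independent copies of the chain ($Q_i$ is $Q$ acting on the $i$-th coordinate). Then the following hold. (1) For every $f:E\to\mathbb R$, $$\lim_{N\to\infty,\;M_N\to\mu}\frac1N e^{-N\langle M_N,f\rangle}\mathcal Q_N e^{N\langle M_N,f\rangle}=\mathcal H(\mu,f):=\sum_{a,b}\mu_a r(a,b)\left(e^{f_b-f_a}-1\right).$$ (2) For $\alpha:E\to\mathbb R$ put $\mathcal L(\mu,\alpha)=\sup_{f}\left(\sum_a f_a\alpha_a-\mathcal H(\mu,f)\right)\in[0,\infty]$. A function $f^*$ realizes the supremum if and only if $\alpha_b=\sum_a\left(\mu_a r(a,b)e^{f^*_b-f^*_a}-\mu_b r(b,a)e^{f^*_a-f^*_b}\right)$ for all $b$. If $\mu_a>0$ for all $a$ and the rates $r$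 are irreducible, such an $f^*$ exists for every $\alpha$ with $\sum_a\alpha_a=0$. (3) Let $f^*$ realize the supremum and put $r^*(b,a)=r(b,a)e^{f^*_a-f^*_b}$. Then $\alpha_b=\sum_a\left(\mu_a r^*(a,b)-\mu_b r^*(b,a)\right)$ for all $b$, that is, the distribution at time $t$ of the chain with rates $r^*$ started from $\mu$ has derivative $\alpha$ at $t=0$. Moreover $$\mathcal L(\mu,\alpha)=\sum_{a,b}\mu_b r(b,a)\left(f^*_ae^{f^*_a-f^*_b}-f^*_be^{f^*_a-f^*_b}-\left(e^{f^*_a-f^*_b}-1\right)\right)$$ and $$\mathcal L(\mu,\alpha)=\sum_{a,b}\mu_b r^*(b,a)\log\frac{r^*(b,a)}{r(b,a)}-\sum_{a,b}\mu_b\left(r^*(b,a)-r(b,a)\right),$$ where terms with $r(b,a)=0$ in the first sum are $0$. (4) For any nonnegative rates $q$ on $E$ and $T>0$ there is exactly one law $P_q^{[0,T]}$, on the space of right-continuous paths $[0,T]\to E$ with left limits, of the continuous-time Markov chain with rates $q$ started from $\mu$. With $f^*$, $r^*$ as in (3), for every $T>0$, $P_{r^*}^{[0,T]}\ll P_r^{[0,T]}$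 and, $P_r^{[0,T]}$-almost surely, $$\frac{dP_{r^*}^{[0,T]}}{dP_r^{[0,T]}}=\exp\left(\sum_{a,b}\left(\log\frac{r^*(b,a)}{r(b,a)}\,N_T^{b,a}-\left(r^*(b,a)-r(b,a)\right)\int_0^T \mathbf 1\{X_s=b\}\,ds\right)\right),$$ where $N_T^{b,a}$ is the number of transitions from $b$ to $a\neq b$ during $[0,T]$, and terms $\log\frac{r^*(b,a)}{r(b,a)}N_T^{b,a}$ with $r(b,a)=0$ are read as $0$. (5) In the situation of (4) the relative entropy $s(P_{r^*}^{[0,T]}\,|\,P_r^{[0,T]})=\int \log\frac{dP_{r^*}^{[0,T]}}{dP_r^{[0,T]}}\,dP_{r^*}^{[0,T]}$ is finite for every $T>0$, and $$\lim_{T\downarrow 0}\frac1T\,s(P_{r^*}^{[0,T]}\,|\,P_r^{[0,T]})=\mathcal L(\mu,\alpha);$$ more precisely, $s(P_{r^*}^{[0,T]}\,|\,P_r^{[0,T]})=T\,\mathcal L(\mu,\alpha)+O(T^2)$ as $T\downarrow 0$. -/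

import Mathlib

open Filter Topology MeasureTheory
open scoped ENNReal Matrix

noncomputable section

namespace FiniteChain

variable {E : Type*} [Fintype E]

/-- The generator `(Q f)(a) = ∑_b r(a,b) (f(b) - f(a))`. The values `r(a,a)` play no role. -/
def generator (r : E → E → ℝ) (f : E → ℝ) (a : E) : ℝ :=
  ∑ b, r a b * (f b - f a)

/-- The generator of `N` independent copies: the sum over `i` of the generator acting on the
`i`-th coordinate. -/
def indepGenerator (r : E → E → ℝ) {N : ℕ} (F : (Fin N → E) → ℝ) (x : Fin N → E) : ℝ :=
  ∑ i, generator r (fun b => F (Function.update x i b)) (x i)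

/-- The pairing `⟨m, f⟩ = ∑_a m_a f_a` of a (signed) measure with a function. -/
def pairing (m f : E → ℝ) : ℝ := ∑ a, m a * f a

/-- The empirical distribution `(1/N) ∑_i δ_{x_i}` of a configuration. -/
def empirical [DecidableEq E] {N : ℕ} (x : Fin N → E) (a : E) : ℝ :=
  (∑ i, if x i = a then (1 : ℝ) else 0) / N

/-- The prelimit `(1/N) e^{-N⟨M_N,f⟩} Q_N e^{N⟨M_N,f⟩}` evaluated at a configuration `x ∈ E^N`,
where `M_N` is the empirical distribution. -/
def preHamiltonian [DecidableEq E] (r : E → E → ℝ) (f : E → ℝ) {N : ℕ} (x : Fin N → E) : ℝ :=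
  (1 / (N : ℝ)) * (Real.exp (-(N * pairing (empirical x) f)) *
    indepGenerator r (fun y : Fin N → E => Real.exp (N * pairing (empirical y) f)) x)

/-- The limit regime `N → ∞`, `M_N(x) → μ`, on configurations of arbitrary size `N`. -/
def configFilter [DecidableEq E] (μ : E → ℝ) : Filter (Σ N : ℕ, (Fin N → E)) :=
  comap (fun p => (p.1, empirical p.2)) (atTop ×ˢ 𝓝 μ)

/-- `H(μ,f) = ∑_{a,b} μ_a r(a,b) (e^{f_b - f_a} - 1)`. -/
def hamiltonian (r : E → E → ℝ) (μ f : E → ℝ) : ℝ :=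
  ∑ a, ∑ b, μ a * r a b * (Real.exp (f b - f a) - 1)

/-- The Lagrangian, the Legendre transform of the Hamiltonian, with values in `[-∞, ∞]`. -/
def lagrangian (r : E → E → ℝ) (μ α : E → ℝ) : EReal :=
  ⨆ f : E → ℝ, ((∑ a, f a * α a - hamiltonian r μ f : ℝ) : EReal)

/-- `f` realizes the supremum that defines the Lagrangian. -/
def RealizesSup (r : E → E → ℝ) (μ α f : E → ℝ) : Prop :=
  lagrangian r μ α = ((∑ a, f a * α a - hamiltonian r μ f : ℝ) : EReal)

/-- The modified rates `r*(b,a) = r(b,a) e^{f_a - f_b}`. -/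
def modifiedRates (r : E → E → ℝ) (f : E → ℝ) (b a : E) : ℝ :=
  r b a * Real.exp (f a - f b)

/-- Every state can be reached from every other one through transitions of positive rate. -/
def Irreducible (r : E → E → ℝ) : Prop :=
  ∀ a b, Relation.ReflTransGen (fun x y => x ≠ y ∧ 0 < r x y) a b

/-- The matrix of the generator: `r(a,b)` off the diagonal and `-∑_{c ≠ a} r(a,c)` on it. -/
def generatorMatrix [DecidableEq E] (r : E → E → ℝ) : Matrix E E ℝ :=
  Matrix.of fun a b => r a b - if a = b then ∑ c, r a c else 0

theorem generatorMatrix_mulVec [DecidableEq E] (r : E → E → ℝ) (f : E → ℝ) :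
    generatorMatrix r *ᵥ f = generator r f := by
  funext a
  simp [generatorMatrix, generator, Matrix.mulVec, dotProduct, sub_mul, mul_sub,
    Finset.sum_sub_distrib, Finset.sum_mul]

/-- The transition probabilities `p_t(a,b)`, the entries of `e^{tQ}`. -/
def transition [DecidableEq E] (r : E → E → ℝ) (t : ℝ) : Matrix E E ℝ :=
  NormedSpace.exp (t • generatorMatrix r)

/-- Right-continuous paths with left limits on `[0,T]`, for the discrete topology on the
state space. -/
def IsCadlag {E : Type*} {T : ℝ} (ω : Set.Icc (0 : ℝ) T → E) : Prop :=
  ∀ t, (∀ᶠ s in 𝓝[>] t, ω s = ω t) ∧ ∃ l, ∀ᶠ s in 𝓝[<] t, ω s = l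

/-- The path space on the time interval `[0,T]`. -/
def PathSpace (E : Type*) (T : ℝ) : Type _ :=
  {ω : Set.Icc (0 : ℝ) T → E // IsCadlag ω}

/-- The σ-algebra generated by the coordinates `ω ↦ ω(t)`. -/
instance (E : Type*) (T : ℝ) : MeasurableSpace (PathSpace E T) :=
  ⨆ t : Set.Icc (0 : ℝ) T, MeasurableSpace.comap (fun ω : PathSpace E T => ω.1 t) ⊤

/-- `P` is the law, on the path space on `[0,T]`, of the continuous-time Markov chain with
rates `r` started from the distribution `μ`. -/
structure IsMarkovLaw [DecidableEq E] (r : E → E → ℝ) (μ : E → ℝ) (T : ℝ)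
    (P : Measure (PathSpace E T)) : Prop where
  isProbabilityMeasure : IsProbabilityMeasure P
  finiteDimensional : ∀ (n : ℕ) (t : Fin (n + 1) → Set.Icc (0 : ℝ) T) (x : Fin (n + 1) → E),
    Monotone t → (t 0 : ℝ) = 0 →
    P {ω | ∀ i, ω.1 (t i) = x i} = ENNReal.ofReal (μ (x 0) *
      ∏ i : Fin n, transition r ((t i.succ : ℝ) - (t i.castSucc : ℝ)) (x i.castSucc) (x i.succ))

/-- The number of transitions from `b` to `a` made by the path during `[0,T]`. -/
def jumpCount {E : Type*} {T : ℝ} (b a : E) (ω : PathSpace E T) : ℕ :=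
  {t : Set.Icc (0 : ℝ) T | b ≠ a ∧ 0 < (t : ℝ) ∧ ω.1 t = a ∧ ∀ᶠ s in 𝓝[<] t, ω.1 s = b}.ncard

/-- The time that the path spends in the state `b` during `[0,T]`. -/
def occupationTime {E : Type*} {T : ℝ} (b : E) (ω : PathSpace E T) : ℝ :=
  (volume {s : ℝ | ∃ h : s ∈ Set.Icc (0 : ℝ) T, ω.1 ⟨s, h⟩ = b}).toReal

end FiniteChain

end

/-! Hamiltonian and Lagrangian. Moving particle `i` from `x i` to `b` changes `N⟨M_N,f⟩` by `f b - f
(x i)`, so the prelimit equals the Hamiltonian at the empirical distribution exactly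
(`preHamiltonian_eq`), and the limit is continuity. The Hamiltonian is convex in `f`, so
stationarity characterizes maximizers (`realizesSup_iff`). In the irreducible case the exponential
growth along edges beats the linear term, which makes the maximization problem coercive modulo
constants (`exists_realizesSup`).

Change of measure. Since `log (r*(b,a)/r(b,a)) = f a - f b` is a gradient, the jump term of the
density telescopes to `f(X_T) - f(X_0)`. What remains is a bounded functional of end points and
occupation times. On a grid of step `h = T/n`, the tilted matrix `e^{f a - f b} p_h(b,a) e^{-hV(a)}`
agrees with the transition matrix of `r*` up to `O(h²)` (`tiltedTransition_sub_isBigO`), so the laws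
of the `n`-step grid paths differ by `O(1/n)` in total variation. Dominated convergence then
identifies the density on cylinder sets (`IsMarkovLaw.eq_withDensity`), without stochastic calculus.
The case `f = 0` gives uniqueness of the law. The jump form of the density is recovered pathwise by
`sum_jumpCount`, together with the almost sure absence of jumps of rate zero.

Entropy. The log-density is explicit, so its mean under `r*` involves only one-time marginals, and
these are analytic in time. Expansion to second order gives `T` times the optimal value
(`exists_abs_klDiv_sub_le`).

Existence of the law. Discrete chains of step `1/n!` have a weak limit point on the compact space of
functions on the rationals. The expected variation along grids stays bounded, hence one-sided limits
exist almost surely, and the right-continuous version has the required law (`exists_isMarkovLaw`).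
-/

namespace FiniteChain

/-! ### Transition matrices as matrix exponentials. -/

section Transition

variable {E : Type*} [Fintype E] [DecidableEq E]

@[simp] lemma transition_zero (r : E → E → ℝ) : transition r 0 = 1 := by
  simp [transition]

lemma transition_nsmul (r : E → E → ℝ) (n : ℕ) (t : ℝ) :
    transition r (n * t) = transition r t ^ n := by
  rw [transition, mul_smul, Nat.cast_smul_eq_nsmul, Matrix.exp_nsmul, transition]

open scoped Matrix.Norms.Operator in
lemma hasDerivAt_transition (r : E → E → ℝ) (t : ℝ) :
    HasDerivAt (transition r) (transition r t * generatorMatrix r) t :=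
  hasDerivAt_exp_smul_const (𝕂 := ℝ) (generatorMatrix r) t

open scoped Matrix.Norms.Operator in
lemma hasDerivAt_transition_apply (r : E → E → ℝ) (t : ℝ) (a b : E) :
    HasDerivAt (fun t => transition r t a b) ((transition r t * generatorMatrix r) a b) t := by
  have h := hasDerivAt_transition r t
  let L : Matrix E E ℝ →L[ℝ] ℝ :=
    LinearMap.toContinuousLinearMap (Matrix.entryLinearMap ℝ ℝ a b)
  exact (L.hasFDerivAt.comp_hasDerivAt t h)

open scoped Matrix.Norms.Operator in
lemma analyticAt_transition_apply (r : E → E → ℝ) (t : ℝ) (a b : E) :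
    AnalyticAt ℝ (fun t => transition r t a b) t := by
  let L : Matrix E E ℝ →L[ℝ] ℝ :=
    LinearMap.toContinuousLinearMap (Matrix.entryLinearMap ℝ ℝ a b)
  have h1 : AnalyticAt ℝ (fun t : ℝ => t • generatorMatrix r) t :=
    analyticAt_id.smul analyticAt_const
  have h2 : AnalyticAt ℝ (fun t : ℝ => NormedSpace.exp (t • generatorMatrix r)) t :=
    (NormedSpace.exp_analytic (𝕂 := ℝ) (t • generatorMatrix r)).comp_of_eq h1 rfl
  exact (L.analyticAt _).comp_of_eq h2 rfl

lemma hasDerivAt_transition_apply_zero (r : E → E → ℝ) (a b : E) :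
    HasDerivAt (fun t => transition r t a b) (generatorMatrix r a b) 0 := by
  simpa using hasDerivAt_transition_apply r 0 a b

lemma continuous_transition_apply (r : E → E → ℝ) (a b : E) :
    Continuous fun t => transition r t a b :=
  continuous_iff_continuousAt.2 fun t => (analyticAt_transition_apply r t a b).continuousAt

lemma sum_generatorMatrix (r : E → E → ℝ) (a : E) : ∑ b, generatorMatrix r a b = 0 := by
  simp [generatorMatrix, Finset.sum_sub_distrib]

lemma sum_transition (r : E → E → ℝ) (t : ℝ) (a : E) : ∑ b, transition r t a b = 1 := by
  have hd : ∀ t, HasDerivAt (fun t => ∑ b, transition r t a b) 0 t := by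
    intro t
    have := HasDerivAt.fun_sum (u := Finset.univ) fun b _ => hasDerivAt_transition_apply r t a b
    have e : ∑ b, (transition r t * generatorMatrix r) a b = 0 := by
      simp only [Matrix.mul_apply]
      rw [Finset.sum_comm]
      simp [← Finset.mul_sum, sum_generatorMatrix]
    rwa [e] at this
  have hc := is_const_of_deriv_eq_zero (fun t => (hd t).differentiableAt)
    (fun t => (hd t).deriv) t 0
  rw [hc]
  simp [Matrix.one_apply]

open scoped Matrix.Norms.Operator in
lemma exp_apply_nonneg {A : Matrix E E ℝ} (hA : ∀ a b, 0 ≤ A a b) (a b : E) :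
    0 ≤ NormedSpace.exp A a b := by
  let L : Matrix E E ℝ →L[ℝ] ℝ :=
    LinearMap.toContinuousLinearMap (Matrix.entryLinearMap ℝ ℝ a b)
  have h := (NormedSpace.exp_series_hasSum_exp' (𝕂 := ℝ) A).mapL L
  have hpow : ∀ (n : ℕ) a b, 0 ≤ (A ^ n) a b := by
    intro n
    induction n with
    | zero => intro a b; simp only [pow_zero, Matrix.one_apply]; split_ifs <;> norm_num
    | succ n ih =>
      intro a b
      rw [pow_succ, Matrix.mul_apply]
      exact Finset.sum_nonneg fun c _ => mul_nonneg (ih a c) (hA c b)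
  refine h.nonneg fun n => ?_
  change 0 ≤ ((n.factorial : ℝ)⁻¹ • A ^ n) a b
  rw [Matrix.smul_apply, smul_eq_mul]
  exact mul_nonneg (by positivity) (hpow n a b)

/-- Adding a multiple `c` of the identity makes every entry of the generator matrix nonnegative. The
scalar part commutes and only contributes the positive factor `e^{-tc}`. -/
lemma transition_nonneg {r : E → E → ℝ} (hr : ∀ a b, a ≠ b → 0 ≤ r a b) {t : ℝ} (ht : 0 ≤ t)
    (a b : E) : 0 ≤ transition r t a b := by
  set c : ℝ := ∑ a, |generatorMatrix r a a| with hc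
  have hcomm : Commute (t • (generatorMatrix r + c • (1 : Matrix E E ℝ)))
      ((-(t * c)) • (1 : Matrix E E ℝ)) := (Commute.one_right _).smul_right _
  have hsplit : t • generatorMatrix r =
      t • (generatorMatrix r + c • (1 : Matrix E E ℝ)) + (-(t * c)) • (1 : Matrix E E ℝ) := by
    rw [smul_add, smul_smul, neg_smul]; abel
  have hscal : NormedSpace.exp ((-(t * c)) • (1 : Matrix E E ℝ))
      = Matrix.diagonal fun _ => Real.exp (-(t * c)) := by
    rw [← Matrix.diagonal_one, ← Matrix.diagonal_smul, Matrix.exp_diagonal]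
    congr 1
    funext i
    rw [Pi.coe_exp]
    simp [Real.exp_eq_exp_ℝ]
  rw [transition, hsplit, Matrix.exp_add_of_commute _ _ hcomm, hscal, Matrix.mul_diagonal]
  refine mul_nonneg (exp_apply_nonneg (fun x y => ?_) a b) (Real.exp_pos _).le
  rw [Matrix.smul_apply, Matrix.add_apply, Matrix.smul_apply, smul_eq_mul, smul_eq_mul]
  refine mul_nonneg ht ?_
  by_cases hxy : x = y
  · subst hxy
    have h1 : |generatorMatrix r x x| ≤ c :=
      Finset.single_le_sum (f := fun a => |generatorMatrix r a a|)
        (fun _ _ => abs_nonneg _) (Finset.mem_univ x)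
    have := neg_abs_le (generatorMatrix r x x)
    simp only [Matrix.one_apply_eq]
    linarith
  · simp [generatorMatrix, hxy, hr x y hxy]

end Transition

/-! ### Quadratic error bounds from first-order agreement. -/

section SecondOrder

/-- Source of all `O(t²)` errors in the file: for expressions analytic in the time step it suffices
to compare values and first derivatives at `0`. -/
lemma isBigO_sq_of_analyticAt {φ : ℝ → ℝ} (h : AnalyticAt ℝ φ 0) (h0 : φ 0 = 0)
    (h1 : HasDerivAt φ 0 0) : φ =O[𝓝 0] fun t => t ^ 2 := by
  obtain ⟨p, hp⟩ := h
  have := hp.isBigO_sub_partialSum_pow 2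
  have hps : ∀ y, p.partialSum 2 y = 0 := by
    intro y
    have e0 : p 0 (fun _ => y) = 0 := by rw [hp.coeff_zero, h0]
    have e1 : p 1 (fun _ => y) = 0 := by
      have hd := hp.hasDerivAt.unique h1
      have : (fun _ : Fin 1 => y) = fun _ : Fin 1 => y • (1 : ℝ) := by simp
      rw [this, (p 1).map_smul_univ (fun _ => y) (fun _ => 1), hd]
      simp
    rw [FormalMultilinearSeries.partialSum, Finset.sum_range_succ, Finset.sum_range_one, e0, e1,
      add_zero]
  simpa [hps] using this

lemma exists_abs_le_sq_of_isBigO {φ : ℝ → ℝ} (h : φ =O[𝓝 0] fun t => t ^ 2) :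
    ∃ C δ : ℝ, 0 ≤ C ∧ 0 < δ ∧ ∀ t, |t| ≤ δ → |φ t| ≤ C * t ^ 2 := by
  obtain ⟨C, hC, hb⟩ := h.exists_nonneg
  obtain ⟨δ, hδ, hball⟩ := Metric.eventually_nhds_iff.1 hb.bound
  refine ⟨C, δ / 2, hC, by positivity, fun t ht => ?_⟩
  have := hball (y := t) (by rw [Real.dist_eq, sub_zero]; linarith)
  simpa using this

/-- A common constant for finitely many second order bounds. -/
lemma exists_uniform_abs_le_sq {ι : Type*} [Finite ι] {φ : ι → ℝ → ℝ}
    (h : ∀ i, φ i =O[𝓝 0] fun t => t ^ 2) :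
    ∃ C δ : ℝ, 0 ≤ C ∧ 0 < δ ∧ ∀ i t, |t| ≤ δ → |φ i t| ≤ C * t ^ 2 := by
  cases nonempty_fintype ι
  have hpi : (fun t : ℝ => fun i => φ i t) =O[𝓝 0] fun t => t ^ 2 := by
    exact Asymptotics.isBigO_pi.2 h
  obtain ⟨C, δ, hC, hδ, hb⟩ := exists_abs_le_sq_of_isBigO (φ := fun t => ‖fun i => φ i t‖)
    hpi.norm_left
  refine ⟨C, δ, hC, hδ, fun i t ht => ?_⟩
  refine le_trans ?_ (le_trans (le_abs_self _) (hb t ht))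
  exact norm_le_pi_norm (fun i => φ i t) i

end SecondOrder

/-! ### The Hamiltonian of independent copies. -/

section Hamiltonian

variable {E : Type*} [Fintype E] [DecidableEq E]

lemma sum_empirical_mul {N : ℕ} (hN : N ≠ 0) (x : Fin N → E) (g : E → ℝ) :
    N * ∑ a, empirical x a * g a = ∑ i, g (x i) := by
  have hN' : (N : ℝ) ≠ 0 := by exact_mod_cast hN
  simp only [empirical, div_mul_eq_mul_div, ← Finset.sum_div, Finset.sum_mul]
  rw [mul_div_cancel₀ _ hN', Finset.sum_comm]
  simp

/-- No limit is involved: the exponent is a sum over particles, so a single move multiplies the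
exponential by `e^{f b - f (x i)}`. -/
lemma preHamiltonian_eq (r : E → E → ℝ) (f : E → ℝ) {N : ℕ} (hN : N ≠ 0) (x : Fin N → E) :
    preHamiltonian r f x = hamiltonian r (empirical x) f := by
  have hN' : (N : ℝ) ≠ 0 := by exact_mod_cast hN
  have hupd : ∀ i b, ∑ j, f (Function.update x i b j) = ∑ j, f (x j) + (f b - f (x i)) := by
    intro i b
    have h1 := Finset.add_sum_erase Finset.univ (fun j => f (x j)) (Finset.mem_univ i)
    have h2 := Finset.add_sum_erase Finset.univ (fun j => f (Function.update x i b j))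
      (Finset.mem_univ i)
    have h3 : ∑ j ∈ Finset.univ.erase i, f (Function.update x i b j)
        = ∑ j ∈ Finset.univ.erase i, f (x j) :=
      Finset.sum_congr rfl fun j hj => by
        rw [Function.update_of_ne (Finset.ne_of_mem_erase hj)]
    simp only [Function.update_self] at h2
    rw [← h1, ← h2, h3]; ring
  have hH : hamiltonian r (empirical x) f
      = 1 / N * ∑ i, ∑ b, r (x i) b * (Real.exp (f b - f (x i)) - 1) := by
    rw [← sum_empirical_mul hN x (fun a => ∑ b, r a b * (Real.exp (f b - f a) - 1)),
      ← mul_assoc, one_div, inv_mul_cancel₀ hN', one_mul]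
    simp only [hamiltonian, Finset.mul_sum, mul_assoc]
  rw [hH, preHamiltonian, indepGenerator]
  congr 1
  rw [Finset.mul_sum]
  refine Finset.sum_congr rfl fun i _ => ?_
  rw [generator, Finset.mul_sum]
  refine Finset.sum_congr rfl fun b _ => ?_
  simp only [pairing, sum_empirical_mul hN, hupd, sub_self, add_zero]
  rw [mul_left_comm, mul_sub, ← Real.exp_add, ← Real.exp_add]
  simp

lemma tendsto_preHamiltonian (r : E → E → ℝ) (μ f : E → ℝ) :
    Tendsto (fun p : (Σ N : ℕ, (Fin N → E)) => preHamiltonian r f p.2)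
      (configFilter μ) (𝓝 (hamiltonian r μ f)) := by
  have hc : Continuous fun m : E → ℝ => hamiltonian r m f := by
    unfold hamiltonian; fun_prop
  have h0 : Tendsto (fun p : (Σ N : ℕ, (Fin N → E)) => (p.1, empirical p.2)) (configFilter μ)
      (atTop ×ˢ 𝓝 μ) := tendsto_comap
  refine ((hc.tendsto μ).comp (tendsto_snd.comp h0)).congr' ?_
  have h1 := (tendsto_fst.comp h0).eventually (eventually_ne_atTop 0)
  filter_upwards [h1] with p hp
  exact (preHamiltonian_eq r f hp p.2).symm

end Hamiltonian

lemma modifiedRates_mul_log {E : Type*} (r : E → E → ℝ) (f : E → ℝ) (b a : E) :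
    modifiedRates r f b a * Real.log (modifiedRates r f b a / r b a)
      = r b a * Real.exp (f a - f b) * (f a - f b) := by
  by_cases h : r b a = 0
  · simp [modifiedRates, h]
  · rw [modifiedRates, mul_div_cancel_left₀ _ h, Real.log_exp]

/-! ### Legendre duality and the value of the Lagrangian. -/

section Lagrangian

variable {E : Type*} [Fintype E]

lemma realizesSup_iff_forall_le {r : E → E → ℝ} {μ α f : E → ℝ} :
    RealizesSup r μ α f ↔ ∀ g : E → ℝ,
      ∑ a, g a * α a - hamiltonian r μ g ≤ ∑ a, f a * α a - hamiltonian r μ f := by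
  unfold RealizesSup lagrangian
  constructor
  · intro h g
    have := le_iSup (fun f : E → ℝ => ((∑ a, f a * α a - hamiltonian r μ f : ℝ) : EReal)) g
    rw [h] at this
    exact_mod_cast this
  · intro h
    refine le_antisymm (iSup_le fun g => by exact_mod_cast h g) ?_
    exact le_iSup (fun f : E → ℝ => ((∑ a, f a * α a - hamiltonian r μ f : ℝ) : EReal)) f

/-- Summation by parts for a flux `m`. -/
lemma sum_mul_flux {α : E → ℝ} {m : E → E → ℝ} (h : ∀ b, α b = ∑ a, (m a b - m b a))
    (u : E → ℝ) : ∑ b, u b * α b = ∑ a, ∑ b, m a b * (u b - u a) := by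
  simp only [h, Finset.mul_sum, mul_sub, Finset.sum_sub_distrib]
  rw [Finset.sum_comm]
  simp only [mul_comm]

/-- Convexity term by term, from `1 + x ≤ e^x`. Diagonal terms vanish on both sides, so the sign of
`r a a` does not matter. -/
lemma hamiltonian_subgradient {r : E → E → ℝ} (hr : ∀ a b, a ≠ b → 0 ≤ r a b) {μ : E → ℝ}
    (hμ : ∀ a, 0 ≤ μ a) (f g : E → ℝ) :
    hamiltonian r μ f
        + ∑ a, ∑ b, μ a * r a b * Real.exp (f b - f a) * ((g b - f b) - (g a - f a))
      ≤ hamiltonian r μ g := by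
  unfold hamiltonian
  rw [← Finset.sum_add_distrib]
  refine Finset.sum_le_sum fun a _ => ?_
  rw [← Finset.sum_add_distrib]
  refine Finset.sum_le_sum fun b _ => ?_
  by_cases hab : a = b
  · subst hab; simp
  have h1 := Real.add_one_le_exp ((g b - g a) - (f b - f a))
  have h2 : Real.exp (g b - g a)
      = Real.exp (f b - f a) * Real.exp ((g b - g a) - (f b - f a)) := by
    rw [← Real.exp_add]; ring_nf
  have h3 : 0 ≤ μ a * r a b * Real.exp (f b - f a) :=
    mul_nonneg (mul_nonneg (hμ a) (hr a b hab)) (Real.exp_pos _).le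
  rw [h2]
  nlinarith [mul_le_mul_of_nonneg_left h1 h3]

lemma hasDerivAt_hamiltonian (r : E → E → ℝ) (μ f u : E → ℝ) :
    HasDerivAt (fun t : ℝ => hamiltonian r μ (f + t • u))
      (∑ a, ∑ b, μ a * r a b * Real.exp (f b - f a) * (u b - u a)) 0 := by
  unfold hamiltonian
  refine HasDerivAt.fun_sum fun a _ => HasDerivAt.fun_sum fun b _ => ?_
  have h1 : HasDerivAt (fun t : ℝ => (f + t • u) b - (f + t • u) a) (u b - u a) 0 := by
    have e : (fun t : ℝ => (f + t • u) b - (f + t • u) a)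
        = fun t : ℝ => (f b - f a) + t * (u b - u a) := by
      funext t; simp; ring
    rw [e]
    simpa using ((hasDerivAt_id (0 : ℝ)).mul_const (u b - u a)).const_add (f b - f a)
  have h2 := ((h1.exp).sub_const 1).const_mul (μ a * r a b)
  simpa [mul_assoc] using h2

/-- Necessity is the vanishing derivative in the direction of the indicator of `b`. For sufficiency,
the flux equation turns the linear term into the slope of the supporting hyperplane at `f`. -/
lemma realizesSup_iff [DecidableEq E] {r : E → E → ℝ} (hr : ∀ a b, a ≠ b → 0 ≤ r a b) {μ : E → ℝ}
    (hμ : ∀ a, 0 ≤ μ a) (α f : E → ℝ) :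
    RealizesSup r μ α f ↔ ∀ b, α b =
      ∑ a, (μ a * r a b * Real.exp (f b - f a) - μ b * r b a * Real.exp (f a - f b)) := by
  rw [realizesSup_iff_forall_le]
  constructor
  · intro h b
    set u : E → ℝ := Pi.single b 1 with hu
    have hd : HasDerivAt
        (fun t : ℝ => ∑ a, (f + t • u) a * α a - hamiltonian r μ (f + t • u))
        (∑ a, u a * α a - ∑ a, ∑ c, μ a * r a c * Real.exp (f c - f a) * (u c - u a)) 0 := by
      refine HasDerivAt.sub (HasDerivAt.fun_sum fun a _ => ?_) (hasDerivAt_hamiltonian r μ f u)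
      simpa using (((hasDerivAt_id (0 : ℝ)).mul_const (u a)).const_add (f a)).mul_const (α a)
    have hmax : IsLocalMax
        (fun t : ℝ => ∑ a, (f + t • u) a * α a - hamiltonian r μ (f + t • u)) 0 :=
      Eventually.of_forall fun t => by simpa using h (f + t • u)
    have h0 := hmax.hasDerivAt_eq_zero hd
    have e1 : ∑ a, u a * α a = α b := by simp [hu, Pi.single_apply]
    rw [e1] at h0
    have e2 : ∑ a, ∑ c, μ a * r a c * Real.exp (f c - f a) * (u c - u a)
        = ∑ a, (μ a * r a b * Real.exp (f b - f a) - μ b * r b a * Real.exp (f a - f b)) := by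
      simp [hu, Pi.single_apply, mul_sub, Finset.sum_sub_distrib, Finset.sum_ite_irrel]
    linarith
  · intro h g
    have h1 := sum_mul_flux (m := fun a b => μ a * r a b * Real.exp (f b - f a)) h (g - f)
    have h2 := hamiltonian_subgradient hr hμ f g
    simp only [Pi.sub_apply, sub_mul, Finset.sum_sub_distrib (fun a => g a * α a)] at h1
    linarith

lemma modifiedRates_velocity {r : E → E → ℝ} {μ α f : E → ℝ}
    (h : ∀ b, α b =
      ∑ a, (μ a * r a b * Real.exp (f b - f a) - μ b * r b a * Real.exp (f a - f b))) (b : E) :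
    α b = ∑ a, (μ a * modifiedRates r f a b - μ b * modifiedRates r f b a) := by
  rw [h b]
  simp only [modifiedRates, mul_assoc]

/-- The value of the Lagrangian in terms of the optimal function. -/
lemma lagrangian_value {r : E → E → ℝ} {μ α f : E → ℝ}
    (h : ∀ b, α b =
      ∑ a, (μ a * r a b * Real.exp (f b - f a) - μ b * r b a * Real.exp (f a - f b))) :
    ∑ a, f a * α a - hamiltonian r μ f =
      ∑ a, ∑ b, μ b * r b a * (f a * Real.exp (f a - f b) - f b * Real.exp (f a - f b)
          - (Real.exp (f a - f b) - 1)) := by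
  rw [sum_mul_flux (m := fun a b => μ a * r a b * Real.exp (f b - f a)) h f, hamiltonian,
    ← Finset.sum_sub_distrib, Finset.sum_comm' (t' := Finset.univ) (s' := fun _ => Finset.univ)
      (by simp)]
  refine Finset.sum_congr rfl fun a _ => ?_
  rw [← Finset.sum_sub_distrib]
  refine Finset.sum_congr rfl fun b _ => ?_
  ring

lemma lagrangian_value_entropy {r : E → E → ℝ} {μ α f : E → ℝ}
    (h : ∀ b, α b =
      ∑ a, (μ a * r a b * Real.exp (f b - f a) - μ b * r b a * Real.exp (f a - f b))) :
    ∑ a, f a * α a - hamiltonian r μ f =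
      ∑ a, ∑ b, μ b * modifiedRates r f b a * Real.log (modifiedRates r f b a / r b a)
        - ∑ a, ∑ b, μ b * (modifiedRates r f b a - r b a) := by
  rw [lagrangian_value h, ← Finset.sum_sub_distrib]
  refine Finset.sum_congr rfl fun a _ => ?_
  rw [← Finset.sum_sub_distrib]
  refine Finset.sum_congr rfl fun b _ => ?_
  rw [mul_assoc (μ b) (modifiedRates r f b a), modifiedRates_mul_log, modifiedRates]
  ring

lemma hasDerivAt_vecMul_transition [DecidableEq E] {r : E → E → ℝ} {μ α : E → ℝ}
    (h : ∀ b, α b = ∑ a, (μ a * r a b - μ b * r b a)) :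
    HasDerivAt (fun t : ℝ => μ ᵥ* transition r t) α 0 := by
  rw [hasDerivAt_pi]
  intro b
  have hd := HasDerivAt.fun_sum (u := Finset.univ) fun a _ =>
    (hasDerivAt_transition_apply_zero r a b).const_mul (μ a)
  have e : ∑ a, μ a * generatorMatrix r a b = α b := by
    rw [h b]
    simp [generatorMatrix, mul_sub, Finset.sum_sub_distrib, Finset.mul_sum]
  rw [e] at hd
  exact hd

end Lagrangian

/-! ### Coercivity and existence of a maximizer. -/

section Existence

variable {E : Type*} [Fintype E]

/-- In an irreducible chain the increments along the edges control all increments. -/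
lemma Irreducible.exists_increment_bound {r : E → E → ℝ} (h : Irreducible r) :
    ∃ K : ℝ, 0 ≤ K ∧ ∀ (f : E → ℝ) (D : ℝ), 0 ≤ D →
      (∀ x y, x ≠ y → 0 < r x y → f y - f x ≤ D) → ∀ a b, f b - f a ≤ K * D := by
  have h1 : ∀ a b, ∃ K : ℝ, 0 ≤ K ∧ ∀ (f : E → ℝ) (D : ℝ), 0 ≤ D →
      (∀ x y, x ≠ y → 0 < r x y → f y - f x ≤ D) → f b - f a ≤ K * D := by
    intro a b
    induction h a b with
    | refl => exact ⟨0, le_rfl, fun f D _ _ => by simp⟩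
    | tail _ hbc ih =>
      obtain ⟨K, hK, hb⟩ := ih
      refine ⟨K + 1, by positivity, fun f D hD hf => ?_⟩
      linarith [hb f D hD hf, hf _ _ hbc.1 hbc.2]
  choose K hK hb using h1
  refine ⟨∑ a, ∑ b, K a b, Finset.sum_nonneg fun a _ => Finset.sum_nonneg fun b _ => hK a b,
    fun f D hD hf a b => (hb a b f D hD hf).trans (mul_le_mul_of_nonneg_right ?_ hD)⟩
  exact (Finset.single_le_sum (f := fun b => K a b) (fun b _ => hK a b) (Finset.mem_univ b)).trans
    (Finset.single_le_sum (f := fun a => ∑ b, K a b)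
      (fun a _ => Finset.sum_nonneg fun b _ => hK a b) (Finset.mem_univ a))

/-- Each summand is at least `-μ a * |r a b|`; after adding these bounds all summands are
nonnegative and a single edge may be kept. -/
lemma hamiltonian_ge_edge [DecidableEq E] {r : E → E → ℝ} (hr : ∀ a b, a ≠ b → 0 ≤ r a b)
    {μ : E → ℝ} (hμ : ∀ a, 0 ≤ μ a) (f : E → ℝ) {x y : E} (hxy : x ≠ y) :
    μ x * r x y * Real.exp (f y - f x) - ∑ a, ∑ b, μ a * |r a b| ≤ hamiltonian r μ f := by
  have hterm : ∀ a b, 0 ≤ μ a * r a b * (Real.exp (f b - f a) - 1) + μ a * |r a b| := by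
    intro a b
    by_cases hab : a = b
    · subst hab; simpa using mul_nonneg (hμ a) (abs_nonneg _)
    · rw [abs_of_nonneg (hr a b hab)]
      have := mul_nonneg (mul_nonneg (hμ a) (hr a b hab)) (Real.exp_pos (f b - f a)).le
      linarith
  have hsum : hamiltonian r μ f + ∑ a, ∑ b, μ a * |r a b|
      = ∑ a, ∑ b, (μ a * r a b * (Real.exp (f b - f a) - 1) + μ a * |r a b|) := by
    simp only [hamiltonian, Finset.sum_add_distrib]
  have h1 : μ x * r x y * (Real.exp (f y - f x) - 1) + μ x * |r x y|
      ≤ ∑ a, ∑ b, (μ a * r a b * (Real.exp (f b - f a) - 1) + μ a * |r a b|) :=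
    (Finset.single_le_sum (f := fun b => μ x * r x b * (Real.exp (f b - f x) - 1) + μ x * |r x b|)
      (fun b _ => hterm x b) (Finset.mem_univ y)).trans
    (Finset.single_le_sum
      (f := fun a => ∑ b, (μ a * r a b * (Real.exp (f b - f a) - 1) + μ a * |r a b|))
      (fun a _ => Finset.sum_nonneg fun b _ => hterm a b) (Finset.mem_univ x))
  rw [abs_of_nonneg (hr x y hxy)] at h1
  linarith

lemma exists_realizesSup [Nonempty E] {r : E → E → ℝ} (hr : ∀ a b, a ≠ b → 0 ≤ r a b)
    {μ : E → ℝ} (hμ : ∀ a, 0 < μ a) (hirr : Irreducible r) {α : E → ℝ} (hα : ∑ a, α a = 0) :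
    ∃ f, RealizesSup r μ α f := by
  classical
  obtain ⟨o⟩ := ‹Nonempty E›
  set J : (E → ℝ) → ℝ := fun f => ∑ a, f a * α a - hamiltonian r μ f with hJ
  obtain ⟨K, hK0, hK⟩ := hirr.exists_increment_bound
  -- a positive lower bound for the weights of the edges
  obtain ⟨c, hc, hcb⟩ : ∃ c : ℝ, 0 < c ∧ ∀ x y, x ≠ y → 0 < r x y → c ≤ μ x * r x y := by
    have hne : (Finset.univ : Finset (E × E)).Nonempty := ⟨(o, o), Finset.mem_univ _⟩
    refine ⟨Finset.univ.inf' hne fun p : E × E => if 0 < r p.1 p.2 then μ p.1 * r p.1 p.2 else 1,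
      ?_, fun x y _ hxy => ?_⟩
    · rw [Finset.lt_inf'_iff]
      intro p _
      split_ifs with hp
      · exact mul_pos (hμ _) hp
      · exact one_pos
    · have := Finset.inf'_le
        (fun p : E × E => if 0 < r p.1 p.2 then μ p.1 * r p.1 p.2 else 1)
        (Finset.mem_univ (x, y))
      rwa [if_pos hxy] at this
  set A : ℝ := ∑ a, |α a| with hA
  set B : ℝ := ∑ a, ∑ b, μ a * |r a b| with hB
  have hA0 : 0 ≤ A := Finset.sum_nonneg fun _ _ => abs_nonneg _
  have hB0 : 0 ≤ B := Finset.sum_nonneg fun a _ => Finset.sum_nonneg fun b _ =>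
    mul_nonneg (hμ a).le (abs_nonneg _)
  -- coercivity
  set M : ℝ := 2 * (A * K + B) / c + 1 with hM
  have hAK : 0 ≤ A * K := mul_nonneg hA0 hK0
  have hM1 : 1 ≤ M := by
    have : 0 ≤ 2 * (A * K + B) / c := by positivity
    linarith
  have hcoer : ∀ f : E → ℝ, f o = 0 → 0 ≤ J f → ∀ a, |f a| ≤ K * M := by
    intro f hfo hf
    by_cases hed : ∀ x y, x ≠ y → 0 < r x y → f y - f x ≤ M
    · intro a
      have h1 := hK f M (by linarith) hed o a
      have h2 := hK f M (by linarith) hed a o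
      rw [abs_le]; constructor <;> linarith
    exfalso
    push Not at hed
    obtain ⟨x₀, y₀, hne₀, hr₀, hlt₀⟩ := hed
    -- the largest increment along an edge
    obtain ⟨p, hp, hpmax⟩ := Finset.exists_max_image
      ((Finset.univ : Finset (E × E)).filter fun p => p.1 ≠ p.2 ∧ 0 < r p.1 p.2)
      (fun p => f p.2 - f p.1) ⟨(x₀, y₀), by simp [hne₀, hr₀]⟩
    simp only [Finset.mem_filter, Finset.mem_univ, true_and, Prod.forall] at hp hpmax
    set D := f p.2 - f p.1 with hD
    have hDM : M < D := hlt₀.trans_le (hpmax x₀ y₀ ⟨hne₀, hr₀⟩)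
    have hD0 : 0 < D := by linarith
    have hosc : ∀ a, |f a| ≤ K * D := by
      intro a
      have h1 := hK f D hD0.le (fun x y h1 h2 => hpmax x y ⟨h1, h2⟩) o a
      have h2 := hK f D hD0.le (fun x y h1 h2 => hpmax x y ⟨h1, h2⟩) a o
      rw [abs_le]; constructor <;> linarith
    have h1 : ∑ a, f a * α a ≤ A * (K * D) := by
      rw [hA, Finset.sum_mul]
      refine Finset.sum_le_sum fun a _ => (le_abs_self _).trans ?_
      rw [abs_mul, mul_comm]
      exact mul_le_mul_of_nonneg_left (hosc a) (abs_nonneg _)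
    have h2 := hamiltonian_ge_edge hr (fun a => (hμ a).le) f hp.1
    -- The quadratic part of the exponential suffices: `D > M` forces `c D² / 2` to exceed `(A K +
    -- B) D`. The summand `1` in `M` ensures `D ≥ 1`, hence `B ≤ B D`.
    have h3 : c * (1 + D + D ^ 2 / 2) ≤ μ p.1 * r p.1 p.2 * Real.exp D :=
      mul_le_mul (hcb _ _ hp.1 hp.2) (Real.quadratic_le_exp_of_nonneg hD0.le) (by positivity)
        (mul_nonneg (hμ _).le hp.2.le)
    have h4 : 2 * (A * K + B) < c * D := by
      have : 2 * (A * K + B) / c < D := by linarith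
      rwa [div_lt_iff₀ hc, mul_comm D] at this
    have h5 : 2 * (A * K + B) * D ≤ c * D * D := mul_le_mul_of_nonneg_right h4.le hD0.le
    have h6 : 0 ≤ B * (D - 1) := mul_nonneg hB0 (by linarith)
    have h7 : 0 < c * D := by positivity
    simp only [hJ] at hf
    nlinarith
  -- a maximizer on a compact set
  have hJc : Continuous J := by
    simp only [hJ, hamiltonian]; fun_prop
  have hcpt : IsCompact {f : E → ℝ | f o = 0 ∧ ∀ a, |f a| ≤ K * M} := by
    refine (isCompact_univ_pi fun _ : E =>
      isCompact_Icc (a := -(K * M)) (b := K * M)).of_isClosed_subset ?_ fun f hf a _ => abs_le.1 (hf.2 a)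
    refine (isClosed_eq (continuous_apply o) continuous_const).inter ?_
    have e : {f : E → ℝ | ∀ a, |f a| ≤ K * M} = ⋂ a, {f : E → ℝ | |f a| ≤ K * M} := by
      ext f; simp
    change IsClosed {f : E → ℝ | ∀ a, |f a| ≤ K * M}
    rw [e]
    exact isClosed_iInter fun a => isClosed_le (by fun_prop) continuous_const
  have hKM : 0 ≤ K * M := mul_nonneg hK0 (by linarith)
  obtain ⟨f, hf, hmax⟩ := hcpt.exists_isMaxOn ⟨0, by simpa using hKM⟩ hJc.continuousOn
  refine ⟨f, realizesSup_iff_forall_le.2 fun g => ?_⟩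
  -- constants do not matter
  have hshift : J (fun a => g a - g o) = J g := by
    simp [hJ, hamiltonian, sub_mul, Finset.sum_sub_distrib, ← Finset.mul_sum, hα]
  change J g ≤ J f
  rw [← hshift]
  have hJ0 : 0 ≤ J f := by
    have h0 := hmax (show (0 : E → ℝ) ∈ _ by simpa using hKM)
    have e0 : J 0 = 0 := by simp [hJ, hamiltonian]
    rwa [Set.mem_ofPred_eq, e0] at h0
  -- Coercivity confines only competitors with nonnegative value; the others lose to `J 0 = 0`.
  rcases le_or_gt 0 (J fun a => g a - g o) with h | h
  · exact hmax ⟨sub_self _, hcoer _ (sub_self _) h⟩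
  · exact h.le.trans hJ0

end Existence

/-! ### Uniform grids on `[0,T]`. -/

section Grid

variable {T : ℝ}

/-- The `k`-th point of the grid with step `T / n`. -/
noncomputable def gridTime (hT : 0 < T) (n k : ℕ) : Set.Icc (0 : ℝ) T :=
  Set.projIcc 0 T hT.le (k * (T / n))

/-- The index of the first point of the grid with step `T / n` that is not before `t`. -/
noncomputable def gridIndex (T : ℝ) (n : ℕ) (t : ℝ) : ℕ := ⌈t / (T / n)⌉₊

lemma coe_gridTime (hT : 0 < T) {n k : ℕ} (hk : k ≤ n) : (gridTime hT n k : ℝ) = k * (T / n) := by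
  have h : (k : ℝ) * (T / n) ∈ Set.Icc (0 : ℝ) T := by
    refine ⟨by positivity, ?_⟩
    rcases Nat.eq_zero_or_pos n with rfl | hn
    · simp [hT.le]
    · have hn' : (0 : ℝ) < n := by exact_mod_cast hn
      rw [mul_div_assoc', div_le_iff₀ hn', mul_comm]
      have : (k : ℝ) ≤ n := by exact_mod_cast hk
      gcongr
  rw [gridTime, Set.projIcc_of_mem _ h]

lemma gridTime_zero (hT : 0 < T) (n : ℕ) : (gridTime hT n 0 : ℝ) = 0 := by
  simpa using coe_gridTime hT (Nat.zero_le n)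

lemma gridTime_last (hT : 0 < T) {n : ℕ} (hn : n ≠ 0) : (gridTime hT n n : ℝ) = T := by
  rw [coe_gridTime hT le_rfl]
  have : (n : ℝ) ≠ 0 := by exact_mod_cast hn
  field_simp

lemma gridTime_mono (hT : 0 < T) (n : ℕ) : Monotone (gridTime hT n) := fun k l hkl =>
  Set.monotone_projIcc _ (by have : (k : ℝ) ≤ l := by exact_mod_cast hkl
                             gcongr)

lemma gridIndex_le (hT : 0 < T) {n : ℕ} (hn : n ≠ 0) {t : ℝ} (ht : t ≤ T) :
    gridIndex T n t ≤ n := by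
  have hn' : (0 : ℝ) < n := by exact_mod_cast Nat.pos_of_ne_zero hn
  rw [gridIndex, Nat.ceil_le, div_le_iff₀ (by positivity)]
  rwa [mul_div_cancel₀ _ hn'.ne']

lemma le_gridIndex (hT : 0 < T) {n : ℕ} (hn : n ≠ 0) (t : ℝ) :
    t ≤ gridIndex T n t * (T / n) := by
  have hn' : (0 : ℝ) < n := by exact_mod_cast Nat.pos_of_ne_zero hn
  rw [← div_le_iff₀ (by positivity)]
  exact Nat.le_ceil _

lemma gridIndex_lt (hT : 0 < T) {n : ℕ} (hn : n ≠ 0) {t : ℝ} (ht : 0 ≤ t) :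
    gridIndex T n t * (T / n) < t + T / n := by
  have hn' : (0 : ℝ) < n := by exact_mod_cast Nat.pos_of_ne_zero hn
  have hh : 0 < T / n := by positivity
  have h := Nat.ceil_lt_add_one (a := t / (T / n)) (by positivity)
  calc gridIndex T n t * (T / n) < (t / (T / n) + 1) * (T / n) := by
        exact mul_lt_mul_of_pos_right h hh
    _ = t + T / n := by field_simp

lemma eventually_step_lt (T : ℝ) {δ : ℝ} (hδ : 0 < δ) : ∀ᶠ n : ℕ in atTop, T / n < δ :=
  (tendsto_const_div_atTop_nhds_zero_nat T).eventually_lt_const hδ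

end Grid

/-! ### Paths observed along fine grids. -/

section Cadlag

variable {E : Type*} {T : ℝ} {ω : Set.Icc (0 : ℝ) T → E}

lemma IsCadlag.exists_right (h : IsCadlag ω) (t : Set.Icc (0 : ℝ) T) :
    ∃ δ > 0, ∀ s : Set.Icc (0 : ℝ) T, t ≤ s → (s : ℝ) < t + δ → ω s = ω t := by
  have h1 := (h t).1
  rw [eventually_nhdsWithin_iff, Metric.eventually_nhds_iff] at h1
  obtain ⟨δ, hδ, hb⟩ := h1
  refine ⟨δ, hδ, fun s hts hs => ?_⟩
  rcases hts.eq_or_lt with rfl | hlt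
  · rfl
  · refine hb ?_ hlt
    have : (t : ℝ) < s := hlt
    rw [Subtype.dist_eq, Real.dist_eq, abs_of_pos (by linarith)]
    linarith

lemma exists_left_of_eventually {t : Set.Icc (0 : ℝ) T} {l : E}
    (h : ∀ᶠ s in 𝓝[<] t, ω s = l) :
    ∃ δ > 0, ∀ s : Set.Icc (0 : ℝ) T, s < t → (t : ℝ) - δ < s → ω s = l := by
  rw [eventually_nhdsWithin_iff, Metric.eventually_nhds_iff] at h
  obtain ⟨δ, hδ, hb⟩ := h
  refine ⟨δ, hδ, fun s hts hs => hb ?_ hts⟩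
  have : (s : ℝ) < t := hts
  rw [Subtype.dist_eq, Real.dist_eq, abs_of_neg (by linarith)]
  linarith

/-- The index is a ceiling, so the grid point is never before `t` and right-continuity applies. -/
lemma IsCadlag.eventually_gridIndex (h : IsCadlag ω) (hT : 0 < T) (t : Set.Icc (0 : ℝ) T) :
    ∀ᶠ n : ℕ in atTop, ω (gridTime hT n (gridIndex T n t)) = ω t := by
  obtain ⟨δ, hδ, hb⟩ := h.exists_right t
  filter_upwards [eventually_ne_atTop 0, eventually_step_lt T hδ] with n hn hstep
  have hc := coe_gridTime hT (gridIndex_le hT hn t.2.2)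
  refine hb _ ?_ ?_
  · rw [← Subtype.coe_le_coe, hc]
    exact le_gridIndex hT hn _
  · rw [hc]
    have := gridIndex_lt hT hn t.2.1
    linarith

/-- A jump of the path is seen by all fine grids. -/
lemma IsCadlag.eventually_exists_grid_jump (h : IsCadlag ω) (hT : 0 < T)
    {t : Set.Icc (0 : ℝ) T} (ht : 0 < (t : ℝ)) {b : E} (hb : ∀ᶠ s in 𝓝[<] t, ω s = b) :
    ∀ᶠ n : ℕ in atTop, ∃ k < n, ω (gridTime hT n k) = b ∧ ω (gridTime hT n (k + 1)) = ω t := by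
  obtain ⟨δ, hδ, hl⟩ := exists_left_of_eventually hb
  filter_upwards [eventually_ne_atTop 0, eventually_step_lt T hδ,
    h.eventually_gridIndex hT t] with n hn hstep hr
  have hn' : (0 : ℝ) < n := by exact_mod_cast Nat.pos_of_ne_zero hn
  have hh : 0 < T / n := by positivity
  have h1 := le_gridIndex hT hn (t : ℝ)
  have h2 := gridIndex_lt hT hn t.2.1
  have h3 := gridIndex_le hT hn t.2.2
  -- Because `t > 0` the index is a successor; the preceding grid point lies strictly before `t` and
  -- within one step of it.
  obtain ⟨k, hk⟩ : ∃ k, gridIndex T n t = k + 1 := by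
    refine Nat.exists_eq_succ_of_ne_zero fun h0 => ?_
    rw [h0] at h1
    simp at h1
    linarith
  rw [hk] at h1 h2 h3 hr
  refine ⟨k, h3, hl _ ?_ ?_, hr⟩
  · rw [← Subtype.coe_lt_coe, coe_gridTime hT (by omega)]
    push_cast at h2
    linarith
  · rw [coe_gridTime hT (by omega)]
    push_cast at h1
    linarith

open Classical in
/-- Riemann sums on the grid converge to the occupation time. -/
lemma tendsto_grid_occupationTime (hT : 0 < T) (ω : PathSpace E T) (b : E) :
    Tendsto (fun n : ℕ => ∑ k ∈ Finset.range n,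
      (T / n) * (if ω.1 (gridTime hT n (k + 1)) = b then 1 else 0)) atTop
      (𝓝 (occupationTime b ω)) := by
  -- Union of the half-open cells whose right end is in state `b`: its volume is the Riemann sum,
  -- and its indicator converges pointwise to that of the occupation set on `(0,T]`.
  set U : ℕ → Set ℝ := fun n =>
    ⋃ k ∈ (Finset.range n).filter (fun k => ω.1 (gridTime hT n (k + 1)) = b),
      Set.Ioc (k * (T / n)) ((k + 1 : ℕ) * (T / n)) with hU
  set A : Set ℝ := {s | ∃ h : s ∈ Set.Icc (0 : ℝ) T, ω.1 ⟨s, h⟩ = b} with hA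
  have hmem : ∀ {n : ℕ}, n ≠ 0 → ∀ s : Set.Icc (0 : ℝ) T, 0 < (s : ℝ) →
      ((s : ℝ) ∈ U n ↔ ω.1 (gridTime hT n (gridIndex T n s)) = b) := by
    intro n hn s hs
    have hn' : (0 : ℝ) < n := by exact_mod_cast Nat.pos_of_ne_zero hn
    have hh : 0 < T / n := by positivity
    have h1 := le_gridIndex hT hn (s : ℝ)
    have h2 := gridIndex_lt hT hn s.2.1
    have h3 := gridIndex_le hT hn s.2.2
    simp only [hU, Set.mem_iUnion, Finset.mem_filter, Finset.mem_range, Set.mem_Ioc, exists_prop]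
    constructor
    · rintro ⟨k, ⟨-, hk⟩, hk1, hk2⟩
      have : gridIndex T n s = k + 1 := by
        rw [gridIndex, Nat.ceil_eq_iff (by omega), lt_div_iff₀ hh, div_le_iff₀ hh]
        exact ⟨by simpa using hk1, hk2⟩
      rwa [this]
    · intro hb
      obtain ⟨k, hk⟩ : ∃ k, gridIndex T n s = k + 1 := by
        refine Nat.exists_eq_succ_of_ne_zero fun h0 => ?_
        rw [h0] at h1
        simp at h1
        linarith
      rw [hk] at hb h1 h2 h3
      refine ⟨k, ⟨h3, hb⟩, ?_, h1⟩
      push_cast at h2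
      linarith
  have hsub : ∀ n : ℕ, U n ⊆ Set.Ioc 0 T := by
    intro n s hs
    simp only [hU, Set.mem_iUnion, Finset.mem_filter, Finset.mem_range, Set.mem_Ioc,
      exists_prop] at hs
    obtain ⟨k, ⟨hk, -⟩, hk1, hk2⟩ := hs
    have hkn := (gridTime hT n (k + 1)).2.2
    rw [coe_gridTime hT hk] at hkn
    refine ⟨lt_of_le_of_lt (by positivity) hk1, hk2.trans hkn⟩
  have hlim : Tendsto (fun n => volume (U n)) atTop (𝓝 (volume (A ∩ Set.Ioi 0))) := by
    refine tendsto_measure_of_tendsto_indicator atTop (B := Set.Ioc 0 T)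
      (fun n => Finset.measurableSet_biUnion _ fun _ _ => measurableSet_Ioc) measurableSet_Ioc
      (by simp) (Eventually.of_forall hsub) fun s => ?_
    by_cases hs : s ∈ Set.Ioc 0 T
    · have hs' : s ∈ Set.Icc 0 T := ⟨hs.1.le, hs.2⟩
      filter_upwards [eventually_ne_atTop 0, ω.2.eventually_gridIndex hT ⟨s, hs'⟩] with n hn he
      rw [hmem hn ⟨s, hs'⟩ hs.1, he]
      simp only [hA, Set.mem_inter_iff, Set.mem_ofPred_eq, Set.mem_Ioi]
      exact ⟨fun h => ⟨⟨hs', h⟩, hs.1⟩, fun h => h.1.2⟩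
    · refine Eventually.of_forall fun n => iff_of_false (fun h => hs (hsub n h)) fun h => ?_
      obtain ⟨⟨h1, -⟩, h2⟩ := h
      exact hs ⟨h2, h1.2⟩
  -- The cells miss only the time `0`, a null set.
  have hAeq : volume (A ∩ Set.Ioi 0) = volume A := by
    refine measure_congr ?_
    have h0 : ∀ᵐ s : ℝ, s ≠ 0 := by simp [ae_iff]
    filter_upwards [h0] with s hs
    refine propext ⟨fun h => h.1, fun h => ⟨h, ?_⟩⟩
    obtain ⟨h1, -⟩ := h
    exact lt_of_le_of_ne h1.1 hs.symm
  have hfin : volume A ≠ ∞ := by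
    refine ne_top_of_le_ne_top (b := volume (Set.Icc 0 T)) (by simp) (measure_mono ?_)
    rintro s ⟨h, -⟩
    exact h
  have hlim' := (ENNReal.tendsto_toReal (hAeq ▸ hfin)).comp hlim
  rw [hAeq] at hlim'
  refine hlim'.congr fun n => ?_
  have hd : (((Finset.range n).filter (fun k => ω.1 (gridTime hT n (k + 1)) = b) : Finset ℕ) :
      Set ℕ).PairwiseDisjoint
      fun k : ℕ => Set.Ioc ((k : ℝ) * (T / n)) ((k + 1 : ℕ) * (T / n)) := by
    have hm : Monotone fun k : ℕ => (k : ℝ) * (T / n) := fun k l hkl => by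
      have : (k : ℝ) ≤ l := by exact_mod_cast hkl
      simp only; gcongr
    exact (hm.pairwise_disjoint_on_Ioc_succ).set_pairwise _
  change (volume (U n)).toReal = _
  rw [hU]
  simp only
  rw [measure_biUnion_finset hd fun _ _ => measurableSet_Ioc, Finset.sum_filter,
    ENNReal.toReal_sum (by intro k _; split_ifs <;> simp)]
  refine Finset.sum_congr rfl fun k _ => ?_
  split_ifs
  · rw [Real.volume_Ioc, ENNReal.toReal_ofReal]
    · push_cast; ring
    · push_cast
      have : 0 ≤ T / n := by positivity
      linarith
  · simp

end Cadlag

/-! ### Jumps of a path add up to its increment. -/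

section Jumps

variable {E : Type*} {T : ℝ}

/-- The times in `(s, t]` at which the path jumps from `b` to `a`. -/
def jumpTimes (ω : Set.Icc (0 : ℝ) T → E) (b a : E) (s t : Set.Icc (0 : ℝ) T) :
    Set (Set.Icc (0 : ℝ) T) :=
  {u | b ≠ a ∧ s < u ∧ u ≤ t ∧ ω u = a ∧ ∀ᶠ v in 𝓝[<] u, ω v = b}

/-- Makes left limits unique. At time `0` the filter is trivial and every state would be a left
limit, which is why jump times are required to be positive. -/
lemma nhdsWithin_Iio_neBot {s u : Set.Icc (0 : ℝ) T} (h : s < u) : (𝓝[<] u).NeBot := by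
  rw [← mem_closure_iff_nhdsWithin_neBot, Metric.mem_closure_iff]
  intro ε hε
  have h' : (s : ℝ) < u := h
  have hm : (s : ℝ) ≤ max (s : ℝ) ((u : ℝ) - ε / 2) := le_max_left _ _
  have hm' : max (s : ℝ) ((u : ℝ) - ε / 2) < u := max_lt h' (by linarith)
  refine ⟨⟨max (s : ℝ) ((u : ℝ) - ε / 2), s.2.1.trans hm, hm'.le.trans u.2.2⟩, hm', ?_⟩
  rw [Subtype.dist_eq, Real.dist_eq, abs_of_pos (by simpa using hm')]
  have := le_max_right (s : ℝ) ((u : ℝ) - ε / 2)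
  simp only
  linarith

/-- The path has finitely many jumps in `(s, t]` and they add up to its increment. -/
def JumpsAddUp [Fintype E] (ω : Set.Icc (0 : ℝ) T → E) (s t : Set.Icc (0 : ℝ) T) : Prop :=
  (∀ b a, (jumpTimes ω b a s t).Finite) ∧ ∀ g : E → ℝ,
    ∑ a, ∑ b, (g a - g b) * ((jumpTimes ω b a s t).ncard : ℝ) = g (ω t) - g (ω s)

lemma JumpsAddUp.trans [Fintype E] {ω : Set.Icc (0 : ℝ) T → E} {s t u : Set.Icc (0 : ℝ) T}
    (hst : s ≤ t) (htu : t ≤ u) (h1 : JumpsAddUp ω s t) (h2 : JumpsAddUp ω t u) :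
    JumpsAddUp ω s u := by
  have hun : ∀ b a, jumpTimes ω b a s u = jumpTimes ω b a s t ∪ jumpTimes ω b a t u := by
    intro b a
    ext v
    simp only [jumpTimes, Set.mem_union, Set.mem_ofPred_eq]
    constructor
    · rintro ⟨h1, h2, h3, h4⟩
      rcases le_or_gt v t with h | h
      · exact Or.inl ⟨h1, h2, h, h4⟩
      · exact Or.inr ⟨h1, h, h3, h4⟩
    · rintro (⟨h1, h2, h3, h4⟩ | ⟨h1, h2, h3, h4⟩)
      · exact ⟨h1, h2, h3.trans htu, h4⟩
      · exact ⟨h1, hst.trans_lt h2, h3, h4⟩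
  have hdis : ∀ b a, Disjoint (jumpTimes ω b a s t) (jumpTimes ω b a t u) := by
    intro b a
    rw [Set.disjoint_left]
    rintro v ⟨-, -, h, -⟩ ⟨-, h', -⟩
    exact absurd h (not_le.2 h')
  refine ⟨fun b a => hun b a ▸ (h1.1 b a).union (h2.1 b a), fun g => ?_⟩
  have := congrArg₂ (· + ·) (h1.2 g) (h2.2 g)
  simp only [← Finset.sum_add_distrib, ← mul_add] at this
  simp only [hun, Set.ncard_union_eq (hdis _ _) (h1.1 _ _) (h2.1 _ _)]
  push_cast
  rw [this]
  ring

/-- Near `u` the path has one constant value before `u` and another from `u` on, so a small window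
contains at most the jump at `u`. -/
lemma IsCadlag.exists_jumpsAddUp_nhds [Fintype E] {ω : Set.Icc (0 : ℝ) T → E} (h : IsCadlag ω)
    (u : Set.Icc (0 : ℝ) T) :
    ∃ U : Set (Set.Icc (0 : ℝ) T), IsOpen U ∧ u ∈ U ∧
      ∀ s t, s ≤ t → s ∈ U → t ∈ U → JumpsAddUp ω s t := by
  classical
  obtain ⟨l, hl⟩ := (h u).2
  obtain ⟨δ, hδ, hleft⟩ := exists_left_of_eventually hl
  obtain ⟨δ', hδ', hright⟩ := h.exists_right u
  refine ⟨{v | (u : ℝ) - δ < v ∧ (v : ℝ) < u + δ'}, ?_, ⟨by linarith, by linarith⟩, ?_⟩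
  · exact (isOpen_lt continuous_const continuous_subtype_val).inter
      (isOpen_lt continuous_subtype_val continuous_const)
  rintro s t hst ⟨hs1, hs2⟩ ⟨ht1, ht2⟩
  have hst' : (s : ℝ) ≤ t := hst
  -- the only possible jump is at `u`
  have honly : ∀ b a v, v ∈ jumpTimes ω b a s t → v = u := by
    rintro b a v ⟨hba, hsv, hvt, hva, hvb⟩
    have hsv' : (s : ℝ) < v := hsv
    have hvt' : (v : ℝ) ≤ t := hvt
    have := nhdsWithin_Iio_neBot hsv
    have hIoo : ∀ᶠ w in 𝓝[<] v, w ∈ Set.Ioo s v := Ioo_mem_nhdsLT hsv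
    rcases lt_trichotomy v u with hvu | hvu | hvu
    · obtain ⟨w, hw, hw1, hw2⟩ := (hvb.and hIoo).exists
      have hw1' : (s : ℝ) < w := hw1
      exact absurd (by rw [← hw, ← hva, hleft w (hw2.trans hvu) (by linarith),
        hleft v hvu (by linarith)]) hba
    · exact hvu
    · have hIoo' : ∀ᶠ w in 𝓝[<] v, w ∈ Set.Ioo u v := Ioo_mem_nhdsLT hvu
      obtain ⟨w, hw, hw1, hw2⟩ := (hvb.and hIoo').exists
      have hw2' : (w : ℝ) < v := hw2
      exact absurd (by rw [← hw, ← hva, hright w hw1.le (by linarith),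
        hright v hvu.le (by linarith)]) hba
  have hset : ∀ b a, jumpTimes ω b a s t
      = if s < u ∧ u ≤ t ∧ b ≠ a ∧ ω u = a ∧ l = b then {u} else ∅ := by
    intro b a
    split_ifs with hc
    · obtain ⟨h1, h2, h3, h4, h5⟩ := hc
      refine Set.Subset.antisymm (fun v hv => honly b a v hv) ?_
      rintro v rfl
      exact ⟨h3, h1, h2, h4, h5 ▸ hl⟩
    · refine Set.eq_empty_of_forall_notMem fun v hv => hc ?_
      have hvu := honly b a v hv
      subst hvu
      obtain ⟨h1, h2, h3, h4, h5⟩ := hv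
      have := nhdsWithin_Iio_neBot h2
      obtain ⟨w, hw, hw'⟩ := (hl.and h5).exists
      exact ⟨h2, h3, h1, h4, hw.symm.trans hw'⟩
  refine ⟨fun b a => by rw [hset]; split_ifs <;> simp, fun g => ?_⟩
  by_cases hsu : s < u ∧ u ≤ t
  · have e1 : ω t = ω u := hright t hsu.2 ht2
    have e2 : ω s = l := hleft s hsu.1 hs1
    have hterm : ∀ a b, (g a - g b) * ((jumpTimes ω b a s t).ncard : ℝ)
        = if ω u = a then (if l = b then g a - g b else 0) else 0 := by
      intro a b
      rw [hset]
      by_cases hba : b = a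
      · subst hba; simp
      · by_cases h1 : ω u = a <;> by_cases h2 : l = b <;> simp [hsu, hba, h1, h2]
    simp only [hterm, Finset.sum_ite_irrel, Finset.sum_ite_eq, Finset.mem_univ, if_true,
      Finset.sum_const_zero]
    rw [e1, e2]
  · have e : ω t = ω s := by
      rcases le_or_gt u s with hus | hus
      · rw [hright s hus hs2, hright t (hus.trans hst) ht2]
      · have htu : t < u := not_le.1 fun h => hsu ⟨hus, h⟩
        rw [hleft s hus hs1, hleft t htu ht1]
    have hterm : ∀ b a, jumpTimes ω b a s t = ∅ := fun b a => by
      rw [hset, if_neg fun hc => hsu ⟨hc.1, hc.2.1⟩]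
    simp [hterm, e]

lemma JumpsAddUp.refl [Fintype E] (ω : Set.Icc (0 : ℝ) T → E) (s : Set.Icc (0 : ℝ) T) :
    JumpsAddUp ω s s := by
  have h : ∀ b a, jumpTimes ω b a s s = ∅ := fun b a =>
    Set.eq_empty_of_forall_notMem fun v hv => absurd hv.2.2.1 (not_le.2 hv.2.1)
  exact ⟨fun b a => by simp [h], fun g => by simp [h]⟩

/-- Compactness of the time interval: a finite subdivision has each piece inside one of the good
windows, and the pieces are concatenated. -/
lemma IsCadlag.jumpsAddUp [Fintype E] {ω : Set.Icc (0 : ℝ) T → E} (h : IsCadlag ω)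
    {s t : Set.Icc (0 : ℝ) T} (hs : (s : ℝ) = 0) (ht : (t : ℝ) = T) : JumpsAddUp ω s t := by
  have hT : (0 : ℝ) ≤ T := s.2.1.trans s.2.2
  choose U hUo hUm hU using h.exists_jumpsAddUp_nhds
  obtain ⟨τ, hτ0, hτm, ⟨m, hm⟩, hτc⟩ := exists_monotone_Icc_subset_open_cover_Icc hT hUo
    (fun u _ => Set.mem_iUnion.2 ⟨u, hUm u⟩)
  have hind : ∀ n, JumpsAddUp ω (τ 0) (τ n) := by
    intro n
    induction n with
    | zero => exact JumpsAddUp.refl ω _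
    | succ n ih =>
      obtain ⟨i, hi⟩ := hτc n
      have hle := hτm (Nat.le_succ n)
      exact ih.trans (hτm (Nat.zero_le n)) hle
        (hU i _ _ hle (hi ⟨le_rfl, hle⟩) (hi ⟨hle, le_rfl⟩))
  have e0 : τ 0 = s := Subtype.ext (hτ0.trans hs.symm)
  have e1 : τ m = t := Subtype.ext ((hm m le_rfl).trans ht.symm)
  rw [← e0, ← e1]
  exact hind m

/-- The jumps of a path add up to its total increment. -/
lemma sum_jumpCount [Fintype E] (ω : PathSpace E T) {s t : Set.Icc (0 : ℝ) T} (hs : (s : ℝ) = 0)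
    (ht : (t : ℝ) = T) (g : E → ℝ) :
    ∑ a, ∑ b, (g a - g b) * (jumpCount b a ω : ℝ) = g (ω.1 t) - g (ω.1 s) := by
  rw [← (ω.2.jumpsAddUp hs ht).2 g]
  have : ∀ b a, jumpCount b a ω = (jumpTimes ω.1 b a s t).ncard := by
    intro b a
    unfold jumpCount jumpTimes
    congr 1
    ext u
    have h1 : s < u ↔ 0 < (u : ℝ) := by rw [← Subtype.coe_lt_coe, hs]
    have h2 : u ≤ t := by rw [← Subtype.coe_le_coe, ht]; exact u.2.2
    simp only [Set.mem_ofPred_eq, h1, h2, true_and]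
  simp only [this]

end Jumps

/-! ### Weights of discrete paths. -/

section PathWeight

variable {E : Type*}

/-- The weight of a finite path with initial weights `μ` and transition weights `p`. -/
def pathWeight {E : Type*} (μ : E → ℝ) (p : E → E → ℝ) {n : ℕ} (x : Fin (n + 1) → E) : ℝ :=
  μ (x 0) * ∏ i : Fin n, p (x i.castSucc) (x i.succ)

lemma sum_snoc [Fintype E] {n : ℕ} (F : (Fin (n + 2) → E) → ℝ) :
    ∑ x, F x = ∑ y : Fin (n + 1) → E, ∑ b, F (Fin.snoc y b) := by
  rw [← Equiv.sum_comp (Fin.snocEquiv fun _ : Fin (n + 2) => E), Fintype.sum_prod_type_right]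
  rfl

lemma pathWeight_snoc (μ : E → ℝ) (p : E → E → ℝ) {n : ℕ} (y : Fin (n + 1) → E) (b : E) :
    pathWeight μ p (Fin.snoc y b : Fin (n + 2) → E)
      = pathWeight μ p y * p (y (Fin.last n)) b := by
  have h0 : (Fin.snoc y b : Fin (n + 2) → E) 0 = y 0 := by
    rw [← Fin.castSucc_zero, Fin.snoc_castSucc (α := fun _ => E)]
  have h1 : ∀ i : Fin (n + 1), (Fin.snoc y b : Fin (n + 2) → E) i.castSucc = y i :=
    fun i => Fin.snoc_castSucc (α := fun _ => E) _ _ _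
  have h2 : (Fin.snoc y b : Fin (n + 2) → E) (Fin.last (n + 1)) = b :=
    Fin.snoc_last (α := fun _ => E) _ _
  rw [pathWeight, pathWeight, h0, Fin.prod_univ_castSucc, h1, Fin.succ_last, h2, mul_assoc]
  congr 2
  refine Finset.prod_congr rfl fun i _ => ?_
  rw [h1, Fin.succ_castSucc, h1]

lemma pathWeight_nonneg {μ : E → ℝ} {p : E → E → ℝ} (hμ : ∀ a, 0 ≤ μ a)
    (hp : ∀ a b, 0 ≤ p a b) {n : ℕ} (x : Fin (n + 1) → E) : 0 ≤ pathWeight μ p x :=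
  mul_nonneg (hμ _) (Finset.prod_nonneg fun _ _ => hp _ _)

lemma sum_pathWeight [Fintype E] {μ : E → ℝ} {p : E → E → ℝ} (hμ : ∑ a, μ a = 1)
    (hp : ∀ a, ∑ b, p a b = 1) (n : ℕ) : ∑ x : Fin (n + 1) → E, pathWeight μ p x = 1 := by
  induction n with
  | zero =>
    rw [← Equiv.sum_comp (Equiv.funUnique (Fin 1) E).symm]
    simpa [pathWeight] using hμ
  | succ n ih =>
    rw [sum_snoc]
    simp only [pathWeight_snoc, ← Finset.mul_sum, hp, mul_one, ih]

/-- The total variation distance of path weights in terms of that of the transition weights. -/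
lemma sum_abs_pathWeight_sub_le [Fintype E] {μ : E → ℝ} {p w : E → E → ℝ} (hμ0 : ∀ a, 0 ≤ μ a)
    (hμ : ∑ a, μ a = 1) (hp0 : ∀ a b, 0 ≤ p a b) (hp : ∀ a, ∑ b, p a b = 1) {ε : ℝ}
    (hε : 0 ≤ ε) (hw : ∀ a, ∑ b, |w a b - p a b| ≤ ε) (n : ℕ) :
    ∑ x : Fin (n + 1) → E, |pathWeight μ w x - pathWeight μ p x| ≤ (1 + ε) ^ n - 1 := by
  have hw1 : ∀ a, ∑ b, |w a b| ≤ 1 + ε := by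
    intro a
    calc ∑ b, |w a b| ≤ ∑ b, (p a b + |w a b - p a b|) := by
          refine Finset.sum_le_sum fun b _ => ?_
          have := abs_add_le (p a b) (w a b - p a b)
          rw [abs_of_nonneg (hp0 a b)] at this
          simpa using this
      _ ≤ 1 + ε := by rw [Finset.sum_add_distrib, hp]; linarith [hw a]
  induction n with
  | zero => simp [pathWeight]
  | succ n ih =>
    rw [sum_snoc]
    simp only [pathWeight_snoc]
    calc ∑ y : Fin (n + 1) → E, ∑ b, |pathWeight μ w y * w (y (Fin.last n)) b
            - pathWeight μ p y * p (y (Fin.last n)) b|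
        ≤ ∑ y : Fin (n + 1) → E, (|pathWeight μ w y - pathWeight μ p y| * (1 + ε)
            + pathWeight μ p y * ε) := by
          refine Finset.sum_le_sum fun y _ => ?_
          -- With `W`, `P` the two path weights, `W w - P p = (W - P) w + P (w - p)`: the old error
          -- grows by the factor `1 + ε`, and the last step adds `ε P`.
          calc ∑ b, |pathWeight μ w y * w (y (Fin.last n)) b
                  - pathWeight μ p y * p (y (Fin.last n)) b|
              ≤ ∑ b, (|pathWeight μ w y - pathWeight μ p y| * |w (y (Fin.last n)) b|
                + pathWeight μ p y * |w (y (Fin.last n)) b - p (y (Fin.last n)) b|) := by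
                refine Finset.sum_le_sum fun b _ => ?_
                rw [← abs_mul, ← abs_of_nonneg (pathWeight_nonneg hμ0 hp0 y), ← abs_mul,
                  abs_of_nonneg (pathWeight_nonneg hμ0 hp0 y)]
                refine le_trans (le_of_eq ?_) (abs_add_le _ _)
                congr 1
                ring
            _ ≤ _ := by
                rw [Finset.sum_add_distrib, ← Finset.mul_sum, ← Finset.mul_sum]
                exact add_le_add (mul_le_mul_of_nonneg_left (hw1 _) (abs_nonneg _))
                  (mul_le_mul_of_nonneg_left (hw _) (pathWeight_nonneg hμ0 hp0 y))
      _ ≤ ((1 + ε) ^ n - 1) * (1 + ε) + 1 * ε := by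
          rw [Finset.sum_add_distrib, ← Finset.sum_mul, ← Finset.sum_mul,
            sum_pathWeight hμ hp]
          have : 0 ≤ 1 + ε := by linarith
          gcongr
      _ = (1 + ε) ^ (n + 1) - 1 := by ring

/-- The gradient factors telescope, which leaves the end points and an additive functional. -/
lemma pathWeight_tilt (μ f v : E → ℝ) (p : E → E → ℝ) {n : ℕ} (x : Fin (n + 1) → E) :
    pathWeight μ (fun b a => Real.exp (f a - f b) * p b a * Real.exp (-(v a))) x =
      pathWeight μ p x * (Real.exp (f (x (Fin.last n)) - f (x 0))
        * Real.exp (-∑ i : Fin n, v (x i.succ))) := by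
  have htel : ∀ (n : ℕ) (x : Fin (n + 1) → E),
      ∑ i : Fin n, (f (x i.succ) - f (x i.castSucc)) = f (x (Fin.last n)) - f (x 0) := by
    intro n x
    have h1 := Fin.sum_univ_castSucc (fun i => f (x i))
    have h2 := Fin.sum_univ_succ (fun i => f (x i))
    rw [Finset.sum_sub_distrib]
    linarith
  simp only [pathWeight, Finset.prod_mul_distrib, ← Real.exp_sum, htel, Finset.sum_neg_distrib]
  ring

end PathWeight

/-! ### Measurability and grid marginals on the path space. -/

section PathSpace

variable {E : Type*} {T : ℝ}

lemma measurable_coord (t : Set.Icc (0 : ℝ) T) :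
    @Measurable _ _ _ ⊤ (fun ω : PathSpace E T => ω.1 t) := by
  have : MeasurableSpace.comap (fun ω : PathSpace E T => ω.1 t) ⊤
      ≤ (inferInstance : MeasurableSpace (PathSpace E T)) :=
    le_iSup (fun t => MeasurableSpace.comap (fun ω : PathSpace E T => ω.1 t) ⊤) t
  exact Measurable.mono (@comap_measurable _ _ ⊤ _) this le_rfl

lemma measurable_comp_coord (g : E → ℝ) (t : Set.Icc (0 : ℝ) T) :
    Measurable fun ω : PathSpace E T => g (ω.1 t) :=
  letI : MeasurableSpace E := ⊤
  (measurable_from_top (f := g)).comp (measurable_coord t)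

lemma measurableSet_coord (t : Set.Icc (0 : ℝ) T) (s : Set E) :
    MeasurableSet {ω : PathSpace E T | ω.1 t ∈ s} :=
  letI : MeasurableSpace E := ⊤
  measurable_coord t (MeasurableSpace.measurableSet_top (s := s))

lemma measurableSet_cylinder (I : Finset (Set.Icc (0 : ℝ) T)) (S : Set.Icc (0 : ℝ) T → Set E) :
    MeasurableSet {ω : PathSpace E T | ∀ t ∈ I, ω.1 t ∈ S t} := by
  have : {ω : PathSpace E T | ∀ t ∈ I, ω.1 t ∈ S t} = ⋂ t ∈ I, {ω | ω.1 t ∈ S t} := by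
    ext; simp
  rw [this]
  exact Finset.measurableSet_biInter _ fun t _ => measurableSet_coord t (S t)

/-- Finite measures on the path space are determined by the cylinder sets. -/
lemma PathSpace.measure_ext {P Q : Measure (PathSpace E T)} [IsFiniteMeasure P]
    (h : ∀ (I : Finset (Set.Icc (0 : ℝ) T)) (S : Set.Icc (0 : ℝ) T → Set E),
      P {ω | ∀ t ∈ I, ω.1 t ∈ S t} = Q {ω | ∀ t ∈ I, ω.1 t ∈ S t}) : P = Q := by
  classical
  refine ext_of_generate_finite
    {A : Set (PathSpace E T) | ∃ (I : Finset (Set.Icc (0 : ℝ) T)) (S : Set.Icc (0 : ℝ) T → Set E),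
      A = {ω | ∀ t ∈ I, ω.1 t ∈ S t}} ?_ ?_ ?_ ?_
  · refine le_antisymm (iSup_le fun t => ?_) (MeasurableSpace.generateFrom_le ?_)
    · rintro A ⟨s, -, rfl⟩
      exact MeasurableSpace.measurableSet_generateFrom ⟨{t}, fun _ => s, by ext; simp⟩
    · rintro A ⟨I, S, rfl⟩
      exact measurableSet_cylinder I S
  · rintro A ⟨I, S, rfl⟩ B ⟨J, R, rfl⟩ -
    refine ⟨I ∪ J, fun t => {a | (t ∈ I → a ∈ S t) ∧ (t ∈ J → a ∈ R t)}, ?_⟩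
    ext ω
    simp only [Set.mem_inter_iff, Set.mem_ofPred_eq, Finset.mem_union]
    constructor
    · rintro ⟨h1, h2⟩ t -
      exact ⟨h1 t, h2 t⟩
    · intro h
      exact ⟨fun t ht => (h t (Or.inl ht)).1 ht, fun t ht => (h t (Or.inr ht)).2 ht⟩
  · rintro A ⟨I, S, rfl⟩
    exact h I S
  · simpa using h ∅ fun _ => Set.univ

/-- The path observed on the grid with step `T / n`. -/
noncomputable def gridPath (hT : 0 < T) (n : ℕ) (ω : PathSpace E T) (i : Fin (n + 1)) : E :=
  ω.1 (gridTime hT n i)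

lemma measurableSet_gridPath (hT : 0 < T) (n : ℕ) (x : Fin (n + 1) → E) :
    MeasurableSet {ω : PathSpace E T | gridPath hT n ω = x} := by
  have : {ω : PathSpace E T | gridPath hT n ω = x}
      = ⋂ i, {ω | ω.1 (gridTime hT n i) ∈ ({x i} : Set E)} := by
    ext ω; simp [funext_iff, gridPath]
  rw [this]
  exact MeasurableSet.iInter fun i => measurableSet_coord _ _

lemma measurable_gridPath [Fintype E] (hT : 0 < T) {n : ℕ} (F : (Fin (n + 1) → E) → ℝ) :
    Measurable fun ω : PathSpace E T => F (gridPath hT n ω) := by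
  have : (fun ω : PathSpace E T => F (gridPath hT n ω))
      = fun ω => ∑ x, Set.indicator {ω | gridPath hT n ω = x} (fun _ => F x) ω := by
    classical
    funext ω
    simp [Set.indicator_apply]
  rw [this]
  exact Finset.measurable_sum _ fun x _ =>
    measurable_const.indicator (measurableSet_gridPath hT n x)

variable [Fintype E] [DecidableEq E] {r : E → E → ℝ} {μ : E → ℝ} {P : Measure (PathSpace E T)}

lemma IsMarkovLaw.measure_gridPath (h : IsMarkovLaw r μ T P) (hT : 0 < T) (n : ℕ)
    (x : Fin (n + 1) → E) :
    P {ω | gridPath hT n ω = x} = ENNReal.ofReal (pathWeight μ (transition r (T / n)) x) := by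
  have h1 := h.finiteDimensional n (fun i => gridTime hT n i) x
    (fun i j hij => gridTime_mono hT n hij) (gridTime_zero hT n)
  have e : {ω : PathSpace E T | gridPath hT n ω = x}
      = {ω | ∀ i : Fin (n + 1), ω.1 (gridTime hT n i) = x i} := by
    ext ω; simp [funext_iff, gridPath]
  rw [e, h1]
  unfold pathWeight
  congr 2
  refine Finset.prod_congr rfl fun i _ => ?_
  have : ((gridTime hT n (i.succ : ℕ) : Set.Icc (0 : ℝ) T) : ℝ) - gridTime hT n (i.castSucc : ℕ)
      = T / n := by
    rw [coe_gridTime hT (by simp), coe_gridTime hT (by simp)]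
    push_cast [Fin.val_succ]
    simp
    ring
  rw [this]

lemma IsMarkovLaw.integral_gridPath (h : IsMarkovLaw r μ T P) (hr : ∀ a b, a ≠ b → 0 ≤ r a b)
    (hμ : ∀ a, 0 ≤ μ a) (hT : 0 < T) (n : ℕ) (F : (Fin (n + 1) → E) → ℝ) :
    ∫ ω, F (gridPath hT n ω) ∂P = ∑ x, pathWeight μ (transition r (T / n)) x * F x := by
  have := h.isProbabilityMeasure
  have e : (fun ω : PathSpace E T => F (gridPath hT n ω))
      = fun ω => ∑ x, Set.indicator {ω | gridPath hT n ω = x} (fun _ => F x) ω := by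
    funext ω
    simp [Set.indicator_apply]
  rw [e, integral_finsetSum _ fun x _ =>
    (integrable_const (F x)).indicator (measurableSet_gridPath hT n x)]
  refine Finset.sum_congr rfl fun x _ => ?_
  rw [integral_indicator (measurableSet_gridPath hT n x), setIntegral_const, smul_eq_mul,
    measureReal_def, h.measure_gridPath hT, ENNReal.toReal_ofReal]
  exact pathWeight_nonneg hμ (transition_nonneg hr (by positivity)) x

end PathSpace

/-! ### One-step comparison of the tilted and the modified chain. -/

section Tilting

variable {E : Type*} [Fintype E]

/-- The potential `b ↦ ∑_a (r*(b,a) - r(b,a))` of the change of rates. -/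
noncomputable def potential (r : E → E → ℝ) (f : E → ℝ) (b : E) : ℝ :=
  ∑ a, (modifiedRates r f b a - r b a)

lemma modifiedRates_nonneg {E : Type*} {r : E → E → ℝ} (hr : ∀ a b, a ≠ b → 0 ≤ r a b) (f : E → ℝ)
    (a b : E) (hab : a ≠ b) : 0 ≤ modifiedRates r f a b :=
  mul_nonneg (hr a b hab) (Real.exp_pos _).le

variable [DecidableEq E]

/-- The transition probabilities reweighted by `f` and the potential. -/
noncomputable def tiltedTransition (r : E → E → ℝ) (f : E → ℝ) (h : ℝ) (b a : E) : ℝ :=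
  Real.exp (f a - f b) * transition r h b a * Real.exp (-(h * potential r f a))

/-- Both matrices are the identity at `h = 0`. Off the diagonal the factor `e^{f a - f b}` turns `r`
into `r*`; on the diagonal the potential is exactly the difference of the total exit rates. -/
lemma tiltedTransition_sub_isBigO (r : E → E → ℝ) (f : E → ℝ) (b a : E) :
    (fun h => tiltedTransition r f h b a - transition (modifiedRates r f) h b a)
      =O[𝓝 0] fun h : ℝ => h ^ 2 := by
  refine isBigO_sq_of_analyticAt ?_ ?_ ?_
  · unfold tiltedTransition
    have h1 := analyticAt_transition_apply r 0 b a
    have h2 := analyticAt_transition_apply (modifiedRates r f) 0 b a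
    have h3 : AnalyticAt ℝ (fun h : ℝ => Real.exp (-(h * potential r f a))) 0 := by fun_prop
    exact ((analyticAt_const.mul h1).mul h3).sub h2
  · by_cases hab : b = a
    · subst hab; simp [tiltedTransition]
    · simp [tiltedTransition, hab]
  · unfold tiltedTransition
    have h1 := hasDerivAt_transition_apply_zero r b a
    have h2 := hasDerivAt_transition_apply_zero (modifiedRates r f) b a
    have h3 : HasDerivAt (fun h : ℝ => Real.exp (-(h * potential r f a))) (-potential r f a) 0 := by
      simpa using (((hasDerivAt_id (0 : ℝ)).mul_const (potential r f a)).neg).exp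
    have h4 := ((h1.const_mul (Real.exp (f a - f b))).mul h3).sub h2
    refine h4.congr_deriv ?_
    by_cases hab : b = a
    · subst hab
      simp only [generatorMatrix, potential, Matrix.of_apply, Finset.sum_sub_distrib]
      simp [modifiedRates]
    · simp [generatorMatrix, hab, modifiedRates, mul_comm]

end Tilting

/-! ### The density and its grid approximation. -/

section Density

variable {E : Type*} [Fintype E] {T : ℝ}

/-- The density of the path measure with the modified rates, through the end points and the
occupation times. -/
noncomputable def density (r : E → E → ℝ) (f : E → ℝ) (hT : 0 < T) (ω : PathSpace E T) : ℝ :=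
  Real.exp (f (ω.1 ⟨T, hT.le, le_rfl⟩) - f (ω.1 ⟨0, le_rfl, hT.le⟩)
    - ∑ b, potential r f b * occupationTime b ω)

/-- The approximation of the density by Riemann sums. -/
noncomputable def gridDensity (r : E → E → ℝ) (f : E → ℝ) (T : ℝ) {n : ℕ} (x : Fin (n + 1) → E) :
    ℝ :=
  Real.exp (f (x (Fin.last n)) - f (x 0)) *
    Real.exp (-∑ i : Fin n, T / n * potential r f (x i.succ))

lemma tendsto_sum_potential (hT : 0 < T) (ω : PathSpace E T) (v : E → ℝ) :
    Tendsto (fun n : ℕ => ∑ i : Fin n, T / n * v (gridPath hT n ω i.succ)) atTop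
      (𝓝 (∑ b, v b * occupationTime b ω)) := by
  classical
  refine (tendsto_finsetSum _ fun b _ =>
    (tendsto_grid_occupationTime hT ω b).const_mul (v b)).congr fun n => ?_
  simp only [Finset.mul_sum]
  rw [Finset.sum_comm, Finset.sum_range]
  refine Finset.sum_congr rfl fun i _ => ?_
  simp [gridPath, mul_comm]

lemma tendsto_gridDensity (r : E → E → ℝ) (f : E → ℝ) (hT : 0 < T) (ω : PathSpace E T) :
    Tendsto (fun n : ℕ => gridDensity r f T (gridPath hT n ω)) atTop (𝓝 (density r f hT ω)) := by
  have h1 := (Real.continuous_exp.tendsto _).comp (tendsto_sum_potential hT ω (potential r f)).neg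
  rw [density, sub_eq_add_neg, Real.exp_add]
  refine (h1.const_mul _).congr' ?_
  filter_upwards [eventually_ne_atTop 0] with n hn
  have e0 : gridTime hT n 0 = ⟨0, le_rfl, hT.le⟩ := Subtype.ext (gridTime_zero hT n)
  have e1 : gridTime hT n n = ⟨T, hT.le, le_rfl⟩ := Subtype.ext (gridTime_last hT hn)
  simp [gridDensity, gridPath, e0, e1]

lemma measurable_density (r : E → E → ℝ) (f : E → ℝ) (hT : 0 < T) :
    Measurable (density (T := T) r f hT) :=
  measurable_of_tendsto_metrizable
    (fun n => measurable_gridPath hT (gridDensity r f T (n := n)))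
    (tendsto_pi_nhds.2 fun ω => tendsto_gridDensity r f hT ω)

lemma abs_sum_potential_le (v : E → ℝ) (hT : 0 < T) {n : ℕ} (x : Fin (n + 1) → E) :
    |∑ i : Fin n, T / n * v (x i.succ)| ≤ T * ∑ b, |v b| := by
  have hB : 0 ≤ ∑ b, |v b| := Finset.sum_nonneg fun _ _ => abs_nonneg _
  rcases Nat.eq_zero_or_pos n with rfl | hn
  · simpa using mul_nonneg hT.le hB
  have hn' : (0 : ℝ) < n := by exact_mod_cast hn
  calc |∑ i : Fin n, T / n * v (x i.succ)| ≤ ∑ i : Fin n, T / n * ∑ b, |v b| := by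
        refine (Finset.abs_sum_le_sum_abs _ _).trans (Finset.sum_le_sum fun i _ => ?_)
        rw [abs_mul, abs_of_nonneg (by positivity : 0 ≤ T / n)]
        exact mul_le_mul_of_nonneg_left (Finset.single_le_sum (f := fun b => |v b|)
          (fun _ _ => abs_nonneg _) (Finset.mem_univ _)) (by positivity)
    _ = T * ∑ b, |v b| := by
        simp
        field_simp

/-- A bound uniform in the grid, as dominated convergence needs; it is available because no jump
counts enter. -/
lemma exists_gridDensity_le (r : E → E → ℝ) (f : E → ℝ) (hT : 0 < T) :
    ∃ C : ℝ, ∀ (n : ℕ) (x : Fin (n + 1) → E), |gridDensity r f T x| ≤ C := by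
  refine ⟨Real.exp (2 * ∑ b, |f b|) * Real.exp (T * ∑ b, |potential r f b|), fun n x => ?_⟩
  rw [gridDensity, abs_of_pos (by positivity)]
  have h1 := abs_sum_potential_le (potential r f) hT x
  have hf : ∀ a, |f a| ≤ ∑ b, |f b| := fun a =>
    Finset.single_le_sum (f := fun b => |f b|) (fun _ _ => abs_nonneg _) (Finset.mem_univ a)
  gcongr
  · have := abs_le.1 (hf (x (Fin.last n)))
    have := abs_le.1 (hf (x 0))
    linarith
  · linarith [(abs_le.1 h1).1]

lemma pathWeight_tiltedTransition [DecidableEq E] (r : E → E → ℝ) (μ f : E → ℝ) {n : ℕ}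
    (x : Fin (n + 1) → E) :
    pathWeight μ (tiltedTransition r f (T / n)) x
      = pathWeight μ (transition r (T / n)) x * gridDensity r f T x :=
  pathWeight_tilt μ f (fun a => T / n * potential r f a) _ x

end Density

/-! ### Absolute continuity and uniqueness of the path law. -/

section ChangeOfMeasure

variable {E : Type*} [Fintype E] [DecidableEq E] {T : ℝ} {r : E → E → ℝ} {μ f : E → ℝ}
  {P Ps : Measure (PathSpace E T)}

/-- Each of the `n` steps costs `O((T/n)²)`, so the total error is at most `e^{K/n} - 1`. -/
lemma tendsto_sum_abs_pathWeight_sub (hr : ∀ a b, a ≠ b → 0 ≤ r a b)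
    (hμ : μ ∈ stdSimplex ℝ E) (hT : 0 < T) :
    Tendsto (fun n : ℕ => ∑ x : Fin (n + 1) → E,
      |pathWeight μ (tiltedTransition r f (T / n)) x
        - pathWeight μ (transition (modifiedRates r f) (T / n)) x|) atTop (𝓝 0) := by
  obtain ⟨C, δ, hC, hδ, hb⟩ := exists_uniform_abs_le_sq (ι := E × E) (φ := fun i h =>
    tiltedTransition r f h i.1 i.2 - transition (modifiedRates r f) h i.1 i.2)
    fun i => tiltedTransition_sub_isBigO r f i.1 i.2
  set K : ℝ := Fintype.card E * C * T ^ 2 with hK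
  have hlim : Tendsto (fun n : ℕ => Real.exp (K / n) - 1) atTop (𝓝 0) := by
    have := (Real.continuous_exp.tendsto 0).comp (tendsto_const_div_atTop_nhds_zero_nat K)
    simpa using this.sub_const 1
  refine squeeze_zero' (Eventually.of_forall fun n => Finset.sum_nonneg fun _ _ => abs_nonneg _)
    ?_ hlim
  filter_upwards [eventually_ne_atTop 0, eventually_step_lt T hδ] with n hn hstep
  have hn' : (0 : ℝ) < n := by exact_mod_cast Nat.pos_of_ne_zero hn
  have hh : 0 ≤ T / n := by positivity
  refine (sum_abs_pathWeight_sub_le (ε := Fintype.card E * (C * (T / n) ^ 2)) hμ.1 hμ.2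
    (transition_nonneg (modifiedRates_nonneg hr f) hh) (sum_transition _ _) (by positivity)
    (fun b => ?_) n).trans ?_
  · calc ∑ a, |tiltedTransition r f (T / n) b a - transition (modifiedRates r f) (T / n) b a|
        ≤ ∑ _a : E, C * (T / n) ^ 2 :=
          Finset.sum_le_sum fun a _ => hb (b, a) _ (by rw [abs_of_nonneg hh]; exact hstep.le)
      _ = _ := by simp
  · have h1 := Real.add_one_le_exp (Fintype.card E * (C * (T / n) ^ 2))
    have h2 : (1 + Fintype.card E * (C * (T / n) ^ 2)) ^ n
        ≤ Real.exp (Fintype.card E * (C * (T / n) ^ 2)) ^ n := by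
      refine pow_le_pow_left₀ (by positivity) (by linarith) n
    rw [← Real.exp_nat_mul] at h2
    have e : (n : ℝ) * (Fintype.card E * (C * (T / n) ^ 2)) = K / n := by
      rw [hK]; field_simp
    rw [e] at h2
    linarith

/-- Tilted path weights are the original weights times `gridDensity`, so for test functions bounded
by `1` the difference is at most the total variation of the weights. -/
lemma tendsto_integral_grid_sub (hr : ∀ a b, a ≠ b → 0 ≤ r a b) (hμ : μ ∈ stdSimplex ℝ E)
    (hT : 0 < T) (hP : IsMarkovLaw r μ T P) (hPs : IsMarkovLaw (modifiedRates r f) μ T Ps)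
    (Φ : ∀ n : ℕ, (Fin (n + 1) → E) → ℝ) (hΦ : ∀ n x, |Φ n x| ≤ 1) :
    Tendsto (fun n : ℕ => ∫ ω, gridDensity r f T (gridPath hT n ω) * Φ n (gridPath hT n ω) ∂P
      - ∫ ω, Φ n (gridPath hT n ω) ∂Ps) atTop (𝓝 0) := by
  refine squeeze_zero_norm (fun n => ?_) (tendsto_sum_abs_pathWeight_sub (f := f) hr hμ hT)
  rw [hP.integral_gridPath hr hμ.1 hT n fun x => gridDensity r f T x * Φ n x,
    hPs.integral_gridPath (modifiedRates_nonneg hr f) hμ.1 hT n (Φ n), ← Finset.sum_sub_distrib]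
  refine (norm_sum_le _ _).trans (Finset.sum_le_sum fun x _ => ?_)
  rw [← mul_assoc, ← pathWeight_tiltedTransition, ← sub_mul, norm_mul, Real.norm_eq_abs,
    Real.norm_eq_abs]
  exact mul_le_of_le_one_right (abs_nonneg _) (hΦ n x)

/-- The law with the modified rates has a density with respect to the original law. -/
theorem IsMarkovLaw.eq_withDensity (hr : ∀ a b, a ≠ b → 0 ≤ r a b) (hμ : μ ∈ stdSimplex ℝ E)
    (hT : 0 < T) (hP : IsMarkovLaw r μ T P) (hPs : IsMarkovLaw (modifiedRates r f) μ T Ps) :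
    Ps = P.withDensity fun ω => ENNReal.ofReal (density r f hT ω) := by
  classical
  have := hP.isProbabilityMeasure
  have := hPs.isProbabilityMeasure
  refine PathSpace.measure_ext fun I S => ?_
  set A : Set (PathSpace E T) := {ω | ∀ t ∈ I, ω.1 t ∈ S t} with hA
  have hAm : MeasurableSet A := measurableSet_cylinder I S
  -- The cylinder event read off the grid at ceiling indices. `Fin.ofNat` reduces modulo `n + 1`,
  -- which changes nothing once `n ≠ 0`, as the indices are then at most `n`.
  let Φ : ∀ n : ℕ, (Fin (n + 1) → E) → ℝ := fun n x =>
    if ∀ t ∈ I, x (Fin.ofNat (n + 1) (gridIndex T n t)) ∈ S t then 1 else 0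
  have hΦ : ∀ n x, |Φ n x| ≤ 1 := by
    intro n x
    simp only [Φ]
    split_ifs <;> simp
  have hΦlim : ∀ ω : PathSpace E T, ∀ᶠ n in atTop,
      Φ n (gridPath hT n ω) = A.indicator (fun _ => (1 : ℝ)) ω := by
    intro ω
    have h1 : ∀ᶠ n in atTop, ∀ t ∈ I, ω.1 (gridTime hT n (gridIndex T n t)) = ω.1 t := by
      rw [Filter.eventually_all_finset]
      exact fun t _ => ω.2.eventually_gridIndex hT t
    filter_upwards [h1, eventually_ne_atTop 0] with n hn hn0
    simp only [Φ, Set.indicator_apply]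
    refine if_congr (forall₂_congr fun t ht => ?_) rfl rfl
    have e : ((Fin.ofNat (n + 1) (gridIndex T n t) : Fin (n + 1)) : ℕ) = gridIndex T n t :=
      Nat.mod_eq_of_lt (Nat.lt_succ_of_le (gridIndex_le hT hn0 t.2.2))
    rw [gridPath, e, hn t ht]
  obtain ⟨C, hC⟩ := exists_gridDensity_le r f hT
  have hC0 : 0 ≤ C := by
    obtain ⟨ω⟩ : Nonempty (PathSpace E T) := P.nonempty_of_neZero
    exact (abs_nonneg _).trans (hC 0 (gridPath hT 0 ω))
  have l1 : Tendsto (fun n : ℕ => ∫ ω, gridDensity r f T (gridPath hT n ω)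
      * Φ n (gridPath hT n ω) ∂P) atTop
      (𝓝 (∫ ω, density r f hT ω * A.indicator (fun _ => (1 : ℝ)) ω ∂P)) := by
    refine tendsto_integral_of_dominated_convergence (fun _ => C)
      (fun n => (measurable_gridPath hT
        fun x => gridDensity r f T x * Φ n x).aestronglyMeasurable)
      (integrable_const C) (fun n => Eventually.of_forall fun ω => ?_)
      (Eventually.of_forall fun ω => ?_)
    · rw [norm_mul]
      exact (mul_le_mul (hC n _) (hΦ n _) (abs_nonneg _) hC0).trans (mul_one C).le
    · exact (tendsto_gridDensity r f hT ω).mul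
        (tendsto_const_nhds.congr' ((hΦlim ω).mono fun n hn => hn.symm))
  have l2 : Tendsto (fun n : ℕ => ∫ ω, Φ n (gridPath hT n ω) ∂Ps) atTop
      (𝓝 (∫ ω, A.indicator (fun _ => (1 : ℝ)) ω ∂Ps)) := by
    refine tendsto_integral_of_dominated_convergence (fun _ => 1)
      (fun n => (measurable_gridPath hT (Φ n)).aestronglyMeasurable)
      (integrable_const 1) (fun n => Eventually.of_forall fun ω => hΦ n _)
      (Eventually.of_forall fun ω =>
        tendsto_const_nhds.congr' ((hΦlim ω).mono fun n hn => hn.symm))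
  have heq := tendsto_nhds_unique (l1.sub l2) (tendsto_integral_grid_sub hr hμ hT hP hPs Φ hΦ)
  rw [sub_eq_zero, integral_indicator_const _ hAm, smul_eq_mul, mul_one] at heq
  have hmul : (fun ω => density r f hT ω * A.indicator (fun _ => (1 : ℝ)) ω)
      = A.indicator (density r f hT) := by
    funext ω
    by_cases h : ω ∈ A <;> simp [h]
  rw [hmul, integral_indicator hAm] at heq
  have hint : Integrable (density r f hT) P := by
    refine Integrable.of_bound (measurable_density r f hT).aestronglyMeasurable C
      (Eventually.of_forall fun ω => ?_)
    exact le_of_tendsto (tendsto_gridDensity r f hT ω).norm (Eventually.of_forall fun n => hC n _)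
  rw [withDensity_apply _ hAm, ← ofReal_integral_eq_lintegral_ofReal hint.integrableOn
    (Eventually.of_forall fun ω => (Real.exp_pos _).le), heq, ofReal_measureReal]

lemma modifiedRates_zero {E : Type*} (r : E → E → ℝ) : modifiedRates r 0 = r := by
  funext b a; simp [modifiedRates]

/-- The law of the chain is determined by the rates and the initial distribution. -/
theorem IsMarkovLaw.unique (hr : ∀ a b, a ≠ b → 0 ≤ r a b) (hμ : μ ∈ stdSimplex ℝ E)
    (hT : 0 < T) (hP : IsMarkovLaw r μ T P) (hPs : IsMarkovLaw r μ T Ps) : Ps = P := by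
  -- With `f = 0` the rates are unchanged and the density is `1`.
  have h := IsMarkovLaw.eq_withDensity (f := 0) hr hμ hT hP (by rwa [modifiedRates_zero])
  have h1 : ∀ ω, density r 0 hT ω = 1 := by
    intro ω
    simp [density, potential, modifiedRates_zero]
  simpa [h1] using h

end ChangeOfMeasure

/-! ### Marginals, jumps of rate zero and the jump form of the density. -/

section Marginals

variable {E : Type*} [Fintype E] [DecidableEq E] {T : ℝ} {r : E → E → ℝ} {μ : E → ℝ}
  {P : Measure (PathSpace E T)}

lemma vecMul_transition_nonneg (hr : ∀ a b, a ≠ b → 0 ≤ r a b) (hμ : ∀ a, 0 ≤ μ a) {t : ℝ}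
    (ht : 0 ≤ t) (a : E) : 0 ≤ (μ ᵥ* transition r t) a :=
  Finset.sum_nonneg fun c _ => mul_nonneg (hμ c) (transition_nonneg hr ht c a)

lemma sum_vecMul_transition (hμ : ∑ a, μ a = 1) (t : ℝ) : ∑ a, (μ ᵥ* transition r t) a = 1 := by
  simp only [Matrix.vecMul, dotProduct]
  rw [Finset.sum_comm]
  simp only [← Finset.mul_sum, sum_transition, mul_one, hμ]

lemma IsMarkovLaw.measure_coord (h : IsMarkovLaw r μ T P) (hr : ∀ a b, a ≠ b → 0 ≤ r a b)
    (hμ : ∀ a, 0 ≤ μ a) (hT : 0 < T) (t : Set.Icc (0 : ℝ) T) (a : E) :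
    P {ω | ω.1 t = a} = ENNReal.ofReal ((μ ᵥ* transition r t) a) := by
  set o : Set.Icc (0 : ℝ) T := ⟨0, le_rfl, hT.le⟩
  -- Finite-dimensional laws are prescribed only for times starting at `0`, hence the decomposition
  -- over the initial state.
  have e : {ω : PathSpace E T | ω.1 t = a}
      = ⋃ c, {ω | ∀ i, ω.1 ((![o, t] : Fin 2 → Set.Icc (0 : ℝ) T) i)
        = (![c, a] : Fin 2 → E) i} := by
    ext ω; simp [Fin.forall_fin_two]
  rw [e, measure_iUnion, tsum_fintype, Matrix.vecMul, dotProduct,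
    ENNReal.ofReal_sum_of_nonneg fun c _ => mul_nonneg (hμ c) (transition_nonneg hr t.2.1 c a)]
  · refine Finset.sum_congr rfl fun c _ => ?_
    rw [h.finiteDimensional 1 ![o, t] ![c, a] ?_ rfl]
    · simp [o]
    · rw [Fin.monotone_iff_le_succ]
      intro i
      fin_cases i
      exact t.2.1
  · intro c d hcd
    rw [Function.onFun, Set.disjoint_left]
    rintro ω h1 h2
    exact hcd ((h1 0).symm.trans (h2 0))
  · intro c
    have : {ω : PathSpace E T | ∀ i, ω.1 ((![o, t] : Fin 2 → Set.Icc (0 : ℝ) T) i)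
        = (![c, a] : Fin 2 → E) i} = ⋂ i, {ω | ω.1 ((![o, t] : Fin 2 → Set.Icc (0 : ℝ) T) i)
          ∈ ({(![c, a] : Fin 2 → E) i} : Set E)} := by
      ext; simp
    rw [this]
    exact MeasurableSet.iInter fun i => measurableSet_coord _ _

lemma IsMarkovLaw.integral_coord (h : IsMarkovLaw r μ T P) (hr : ∀ a b, a ≠ b → 0 ≤ r a b)
    (hμ : ∀ a, 0 ≤ μ a) (hT : 0 < T) (t : Set.Icc (0 : ℝ) T) (g : E → ℝ) :
    ∫ ω, g (ω.1 t) ∂P = ∑ a, (μ ᵥ* transition r t) a * g a := by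
  have := h.isProbabilityMeasure
  have hm : ∀ a, MeasurableSet {ω : PathSpace E T | ω.1 t = a} := fun a => measurableSet_coord t {a}
  have e : (fun ω : PathSpace E T => g (ω.1 t))
      = fun ω => ∑ a, Set.indicator {ω | ω.1 t = a} (fun _ => g a) ω := by
    funext ω
    simp [Set.indicator_apply]
  rw [e, integral_finsetSum _ fun a _ => (integrable_const (g a)).indicator (hm a)]
  refine Finset.sum_congr rfl fun a _ => ?_
  rw [integral_indicator (hm a), setIntegral_const, smul_eq_mul, measureReal_def,
    h.measure_coord hr hμ hT, ENNReal.toReal_ofReal (vecMul_transition_nonneg hr hμ t.2.1 a)]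

lemma IsMarkovLaw.measure_pair_le (h : IsMarkovLaw r μ T P) (hr : ∀ a b, a ≠ b → 0 ≤ r a b)
    (hμ : μ ∈ stdSimplex ℝ E) (hT : 0 < T) {s t : Set.Icc (0 : ℝ) T} (hst : s ≤ t) (b a : E) :
    P {ω | ω.1 s = b ∧ ω.1 t = a} ≤ ENNReal.ofReal (transition r (t - s) b a) := by
  set o : Set.Icc (0 : ℝ) T := ⟨0, le_rfl, hT.le⟩
  have hst' : (0 : ℝ) ≤ t - s := sub_nonneg.2 hst
  have e : {ω : PathSpace E T | ω.1 s = b ∧ ω.1 t = a}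
      = ⋃ c, {ω | ∀ i, ω.1 ((![o, s, t] : Fin 3 → Set.Icc (0 : ℝ) T) i)
        = (![c, b, a] : Fin 3 → E) i} := by
    ext ω; simp [Fin.forall_fin_succ]
  rw [e]
  refine (measure_iUnion_fintype_le _ _).trans ?_
  have hterm : ∀ c, P {ω | ∀ i, ω.1 ((![o, s, t] : Fin 3 → Set.Icc (0 : ℝ) T) i)
        = (![c, b, a] : Fin 3 → E) i}
      = ENNReal.ofReal (μ c * transition r s c b * transition r (t - s) b a) := by
    intro c
    rw [h.finiteDimensional 2 ![o, s, t] ![c, b, a] ?_ rfl]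
    · simp [o, Fin.prod_univ_two, mul_assoc]
    · rw [Fin.monotone_iff_le_succ]
      intro i
      fin_cases i
      · exact s.2.1
      · exact hst
  simp only [hterm]
  have hnn := transition_nonneg hr hst' b a
  rw [← ENNReal.ofReal_sum_of_nonneg fun c _ =>
    mul_nonneg (mul_nonneg (hμ.1 c) (transition_nonneg hr s.2.1 c b)) hnn, ← Finset.sum_mul]
  refine ENNReal.ofReal_le_ofReal (mul_le_of_le_one_left hnn ?_)
  have h1 := sum_vecMul_transition (r := r) hμ.2 s
  rw [← h1]
  exact Finset.single_le_sum (f := fun a => (μ ᵥ* transition r s) a)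
    (fun a _ => vecMul_transition_nonneg hr hμ.1 s.2.1 a) (Finset.mem_univ b)

/-- Transitions of rate zero do not occur. -/
lemma IsMarkovLaw.ae_jumpCount_eq_zero (h : IsMarkovLaw r μ T P)
    (hr : ∀ a b, a ≠ b → 0 ≤ r a b) (hμ : μ ∈ stdSimplex ℝ E) (hT : 0 < T) {b a : E}
    (hba : b ≠ a) (h0 : r b a = 0) : ∀ᵐ ω ∂P, jumpCount b a ω = 0 := by
  set A : ℕ → Set (PathSpace E T) := fun n =>
    ⋃ k : Fin n, {ω | ω.1 (gridTime hT n k) = b ∧ ω.1 (gridTime hT n (k + 1)) = a} with hA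
  -- For rate zero the transition probability is `O(h²)`, so the `n` cells together contribute
  -- `O(1/n)`.
  have hO : (fun t => transition r t b a) =O[𝓝 0] fun t : ℝ => t ^ 2 := by
    refine isBigO_sq_of_analyticAt (analyticAt_transition_apply r 0 b a) (by simp [hba]) ?_
    have := hasDerivAt_transition_apply_zero r b a
    rwa [show generatorMatrix r b a = 0 by simp [generatorMatrix, hba, h0]] at this
  obtain ⟨C, δ, hC, hδ, hb⟩ := exists_abs_le_sq_of_isBigO hO
  have hle : ∀ᶠ n : ℕ in atTop, P (A n) ≤ ENNReal.ofReal (C * T ^ 2 / n) := by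
    filter_upwards [eventually_ne_atTop 0, eventually_step_lt T hδ] with n hn hstep
    have hn' : (0 : ℝ) < n := by exact_mod_cast Nat.pos_of_ne_zero hn
    have hh : 0 ≤ T / n := by positivity
    calc P (A n) ≤ ∑ k : Fin n, P {ω | ω.1 (gridTime hT n k) = b ∧
            ω.1 (gridTime hT n (k + 1)) = a} := measure_iUnion_fintype_le _ _
      _ ≤ ∑ _k : Fin n, ENNReal.ofReal (C * (T / n) ^ 2) := by
          refine Finset.sum_le_sum fun k _ =>
            (h.measure_pair_le hr hμ hT (gridTime_mono hT n (Nat.le_succ _)) b a).trans ?_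
          refine ENNReal.ofReal_le_ofReal ?_
          have e : ((gridTime hT n (k + 1) : Set.Icc (0 : ℝ) T) : ℝ) - gridTime hT n k = T / n := by
            rw [coe_gridTime hT k.2, coe_gridTime hT k.2.le]
            push_cast; ring
          rw [e]
          exact (le_abs_self _).trans (hb _ (by rw [abs_of_nonneg hh]; exact hstep.le))
      _ = ENNReal.ofReal (C * T ^ 2 / n) := by
          rw [Finset.sum_const, Finset.card_univ, Fintype.card_fin, nsmul_eq_mul,
            ← ENNReal.ofReal_natCast, ← ENNReal.ofReal_mul hn'.le]
          congr 1
          field_simp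
  have hlim : Tendsto (fun n => P (A n)) atTop (𝓝 0) := by
    have h1 := ENNReal.tendsto_ofReal (tendsto_const_div_atTop_nhds_zero_nat (C * T ^ 2))
    rw [ENNReal.ofReal_zero] at h1
    exact tendsto_of_tendsto_of_tendsto_of_le_of_le' tendsto_const_nhds h1
      (Eventually.of_forall fun _ => zero_le) hle
  -- A jump is seen by all sufficiently fine grids, so it lies in the lower limit of the events `A
  -- n`. The null-set argument does not need measurability of `jumpCount`.
  have hsub : {ω : PathSpace E T | ¬ jumpCount b a ω = 0} ⊆ ⋃ m, ⋂ n ∈ Set.Ici m, A n := by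
    intro ω hω
    have hne : {t : Set.Icc (0 : ℝ) T | b ≠ a ∧ 0 < (t : ℝ) ∧ ω.1 t = a ∧
        ∀ᶠ s in 𝓝[<] t, ω.1 s = b}.Nonempty := by
      rw [Set.nonempty_iff_ne_empty]
      intro he
      exact hω (by rw [jumpCount, he, Set.ncard_empty])
    obtain ⟨t, -, ht0, hta, htb⟩ := hne
    obtain ⟨m, hm⟩ := eventually_atTop.1 (ω.2.eventually_exists_grid_jump hT ht0 htb)
    refine Set.mem_iUnion.2 ⟨m, Set.mem_iInter₂.2 fun n hn => ?_⟩
    obtain ⟨k, hk, h1, h2⟩ := hm n hn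
    exact Set.mem_iUnion.2 ⟨⟨k, hk⟩, h1, h2.trans hta⟩
  refine measure_mono_null hsub (measure_iUnion_null fun m => ?_)
  refine le_antisymm (ge_of_tendsto hlim ?_) zero_le
  filter_upwards [eventually_ge_atTop m] with n hn
  exact measure_mono (Set.iInter₂_subset n hn)

/-- The increment of `f` is rewritten as a sum over jumps. The logarithm equals `f a - f b` wherever
the rate is nonzero; elsewhere the jump count vanishes almost surely. -/
lemma IsMarkovLaw.ae_density_eq (h : IsMarkovLaw r μ T P)
    (hr : ∀ a b, a ≠ b → 0 ≤ r a b) (hμ : μ ∈ stdSimplex ℝ E) (hT : 0 < T) (f : E → ℝ) :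
    ∀ᵐ ω ∂P, density r f hT ω = Real.exp (∑ a, ∑ b,
      (Real.log (modifiedRates r f b a / r b a) * (jumpCount b a ω : ℝ)
        - (modifiedRates r f b a - r b a) * occupationTime b ω)) := by
  have h1 : ∀ᵐ ω ∂P, ∀ b a, b ≠ a → r b a = 0 → jumpCount b a ω = 0 := by
    simp only [ae_all_iff]
    exact fun b a hba h0 => h.ae_jumpCount_eq_zero hr hμ hT hba h0
  filter_upwards [h1] with ω hω
  rw [density, ← sum_jumpCount ω (s := ⟨0, le_rfl, hT.le⟩) (t := ⟨T, hT.le, le_rfl⟩) rfl rfl f]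
  have e : ∑ b, potential r f b * occupationTime b ω
      = ∑ a, ∑ b, (modifiedRates r f b a - r b a) * occupationTime b ω := by
    rw [Finset.sum_comm]
    simp only [potential, Finset.sum_mul]
  rw [e, ← Finset.sum_sub_distrib]
  congr 1
  refine Finset.sum_congr rfl fun a _ => ?_
  rw [← Finset.sum_sub_distrib]
  refine Finset.sum_congr rfl fun b _ => ?_
  congr 1
  by_cases hba : b = a
  · subst hba
    have : jumpCount b b ω = 0 := by simp [jumpCount]
    simp [this]
  by_cases h0 : r b a = 0
  · simp [hω b a hba h0]
  · rw [modifiedRates, mul_div_cancel_left₀ _ h0, Real.log_exp]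

end Marginals

/-! ### Integrability of occupation functionals. -/

section Occupation

variable {E : Type*} [Fintype E] {T : ℝ} {P : Measure (PathSpace E T)}

lemma abs_sum_potential_occupationTime_le (v : E → ℝ) (hT : 0 < T) (ω : PathSpace E T) :
    |∑ b, v b * occupationTime b ω| ≤ T * ∑ b, |v b| :=
  le_of_tendsto (tendsto_sum_potential hT ω v).abs
    (Eventually.of_forall fun _ => abs_sum_potential_le v hT _)

lemma measurable_sum_potential_occupationTime (v : E → ℝ) (hT : 0 < T) :
    Measurable fun ω : PathSpace E T => ∑ b, v b * occupationTime b ω :=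
  measurable_of_tendsto_metrizable
    (fun n => measurable_gridPath hT fun x : Fin (n + 1) → E => ∑ i : Fin n, T / n * v (x i.succ))
    (tendsto_pi_nhds.2 fun ω => tendsto_sum_potential hT ω v)

lemma integrable_sum_potential_occupationTime [IsFiniteMeasure P] (v : E → ℝ) (hT : 0 < T) :
    Integrable (fun ω : PathSpace E T => ∑ b, v b * occupationTime b ω) P :=
  Integrable.of_bound (measurable_sum_potential_occupationTime v hT).aestronglyMeasurable _
    (Eventually.of_forall fun ω => abs_sum_potential_occupationTime_le v hT ω)

lemma integrable_coord [IsFiniteMeasure P] (g : E → ℝ) (t : Set.Icc (0 : ℝ) T) :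
    Integrable (fun ω : PathSpace E T => g (ω.1 t)) P :=
  Integrable.of_bound (measurable_comp_coord g t).aestronglyMeasurable (∑ b, |g b|)
    (Eventually.of_forall fun _ => Finset.single_le_sum (f := fun b => |g b|)
      (fun _ _ => abs_nonneg _) (Finset.mem_univ _))

/-- Links the two sides of the theory: the mean rate of the compensator at time `0` is the
Hamiltonian. -/
lemma sum_mul_potential (r : E → E → ℝ) (μ f : E → ℝ) :
    ∑ b, μ b * potential r f b = hamiltonian r μ f := by
  simp only [potential, modifiedRates, hamiltonian, Finset.mul_sum]
  refine Finset.sum_congr rfl fun a _ => Finset.sum_congr rfl fun b _ => ?_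
  ring

end Occupation

/-! ### Relative entropy and its short-time expansion. -/

section Entropy

variable {E : Type*} [Fintype E] [DecidableEq E] {T : ℝ} {r : E → E → ℝ} {μ f : E → ℝ}
  {P Ps : Measure (PathSpace E T)}

lemma IsMarkovLaw.absolutelyContinuous (hr : ∀ a b, a ≠ b → 0 ≤ r a b)
    (hμ : μ ∈ stdSimplex ℝ E) (hT : 0 < T) (hP : IsMarkovLaw r μ T P)
    (hPs : IsMarkovLaw (modifiedRates r f) μ T Ps) : Ps ≪ P := by
  rw [hP.eq_withDensity hr hμ hT hPs]
  exact withDensity_absolutelyContinuous _ _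

lemma IsMarkovLaw.rnDeriv_eq (hr : ∀ a b, a ≠ b → 0 ≤ r a b)
    (hμ : μ ∈ stdSimplex ℝ E) (hT : 0 < T) (hP : IsMarkovLaw r μ T P)
    (hPs : IsMarkovLaw (modifiedRates r f) μ T Ps) :
    Ps.rnDeriv P =ᵐ[P] fun ω => ENNReal.ofReal (density r f hT ω) := by
  have := hP.isProbabilityMeasure
  rw [hP.eq_withDensity hr hμ hT hPs]
  exact Measure.rnDeriv_withDensity P (measurable_density r f hT).ennreal_ofReal

lemma IsMarkovLaw.llr_eq (hr : ∀ a b, a ≠ b → 0 ≤ r a b)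
    (hμ : μ ∈ stdSimplex ℝ E) (hT : 0 < T) (hP : IsMarkovLaw r μ T P)
    (hPs : IsMarkovLaw (modifiedRates r f) μ T Ps) :
    llr Ps P =ᵐ[Ps] fun ω => f (ω.1 ⟨T, hT.le, le_rfl⟩) - f (ω.1 ⟨0, le_rfl, hT.le⟩)
      - ∑ b, potential r f b * occupationTime b ω := by
  filter_upwards [(hP.absolutelyContinuous hr hμ hT hPs).ae_le (hP.rnDeriv_eq hr hμ hT hPs)]
    with ω hω
  rw [llr, hω, density, ENNReal.toReal_ofReal (Real.exp_pos _).le, Real.log_exp]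

lemma IsMarkovLaw.klDiv_ne_top (hr : ∀ a b, a ≠ b → 0 ≤ r a b)
    (hμ : μ ∈ stdSimplex ℝ E) (hT : 0 < T) (hP : IsMarkovLaw r μ T P)
    (hPs : IsMarkovLaw (modifiedRates r f) μ T Ps) : InformationTheory.klDiv Ps P ≠ ∞ := by
  have := hPs.isProbabilityMeasure
  refine InformationTheory.klDiv_ne_top (hP.absolutelyContinuous hr hμ hT hPs) ?_
  rw [integrable_congr (hP.llr_eq hr hμ hT hPs)]
  exact ((integrable_coord f _).sub (integrable_coord f _)).sub
    (integrable_sum_potential_occupationTime _ hT)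

/-- The relative entropy of the path measures. -/
lemma IsMarkovLaw.toReal_klDiv (hr : ∀ a b, a ≠ b → 0 ≤ r a b)
    (hμ : μ ∈ stdSimplex ℝ E) (hT : 0 < T) (hP : IsMarkovLaw r μ T P)
    (hPs : IsMarkovLaw (modifiedRates r f) μ T Ps) :
    (InformationTheory.klDiv Ps P).toReal =
      ∑ a, f a * ((μ ᵥ* transition (modifiedRates r f) T) a - μ a)
        - ∫ ω, ∑ b, potential r f b * occupationTime b ω ∂Ps := by
  have := hP.isProbabilityMeasure
  have := hPs.isProbabilityMeasure
  have hrs := modifiedRates_nonneg hr f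
  have hint : Integrable (fun ω : PathSpace E T => f (ω.1 ⟨T, hT.le, le_rfl⟩)
      - f (ω.1 ⟨0, le_rfl, hT.le⟩)) Ps := (integrable_coord f _).sub (integrable_coord f _)
  -- Both measures have mass one, so the divergence is the integral of the log-likelihood ratio
  -- without a mass correction.
  rw [InformationTheory.toReal_klDiv_of_measure_eq (hP.absolutelyContinuous hr hμ hT hPs)
    (by simp), integral_congr_ae (hP.llr_eq hr hμ hT hPs),
    integral_sub hint (integrable_sum_potential_occupationTime _ hT),
    integral_sub (integrable_coord f _) (integrable_coord f _),
    hPs.integral_coord hrs hμ.1 hT, hPs.integral_coord hrs hμ.1 hT]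
  simp only [transition_zero, Matrix.vecMul_one, mul_sub, Finset.sum_sub_distrib, mul_comm]

/-- Mean occupation times are close to those of the initial distribution. -/
lemma IsMarkovLaw.abs_integral_occupationTime_sub_le (hr : ∀ a b, a ≠ b → 0 ≤ r a b)
    (hμ : μ ∈ stdSimplex ℝ E) (hT : 0 < T) (hP : IsMarkovLaw r μ T P) (v : E → ℝ) {B : ℝ}
    (hB : ∀ t ∈ Set.Icc 0 T, |∑ a, (μ ᵥ* transition r t) a * v a - ∑ a, μ a * v a| ≤ B) :
    |∫ ω, ∑ b, v b * occupationTime b ω ∂P - T * ∑ a, μ a * v a| ≤ T * B := by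
  have := hP.isProbabilityMeasure
  -- Riemann sums replace the exchange of the time integral with the expectation.
  have hlim : Tendsto (fun n : ℕ => ∫ ω, ∑ i : Fin n, T / n * v (gridPath hT n ω i.succ) ∂P) atTop
      (𝓝 (∫ ω, ∑ b, v b * occupationTime b ω ∂P)) := by
    refine tendsto_integral_of_dominated_convergence (fun _ => T * ∑ b, |v b|)
      (fun n => (measurable_gridPath hT fun x : Fin (n + 1) → E =>
        ∑ i : Fin n, T / n * v (x i.succ)).aestronglyMeasurable)
      (integrable_const _) (fun n => Eventually.of_forall fun ω => abs_sum_potential_le v hT _)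
      (Eventually.of_forall fun ω => tendsto_sum_potential hT ω v)
  refine le_of_tendsto (hlim.sub_const _).abs ?_
  filter_upwards [eventually_ne_atTop 0] with n hn
  have hn' : (0 : ℝ) < n := by exact_mod_cast Nat.pos_of_ne_zero hn
  have hh : 0 ≤ T / n := by positivity
  have e1 : ∫ ω, ∑ i : Fin n, T / n * v (gridPath hT n ω i.succ) ∂P
      = ∑ i : Fin n, T / n * ∑ a, (μ ᵥ* transition r (gridTime hT n i.succ)) a * v a := by
    have hint : ∀ i : Fin n, Integrable
        (fun ω : PathSpace E T => T / n * v (gridPath hT n ω i.succ)) P :=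
      fun i => (integrable_coord v (gridTime hT n i.succ)).const_mul _
    rw [integral_finsetSum _ fun i _ => hint i]
    refine Finset.sum_congr rfl fun i _ => ?_
    rw [integral_const_mul]
    congr 1
    exact hP.integral_coord hr hμ.1 hT _ v
  have e2 : T * ∑ a, μ a * v a = ∑ _i : Fin n, T / n * ∑ a, μ a * v a := by
    simp
    field_simp
  have e3 : T * B = ∑ _i : Fin n, T / n * B := by
    simp
    field_simp
  rw [e1, e2, e3, ← Finset.sum_sub_distrib]
  refine (Finset.abs_sum_le_sum_abs _ _).trans (Finset.sum_le_sum fun i _ => ?_)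
  rw [← mul_sub, abs_mul, abs_of_nonneg hh]
  exact mul_le_mul_of_nonneg_left (hB _ (gridTime hT n i.succ).2) hh

/-- Second order expansion of the relative entropy for short times. -/
lemma exists_abs_klDiv_sub_le {α : E → ℝ} (hr : ∀ a b, a ≠ b → 0 ≤ r a b)
    (hμ : μ ∈ stdSimplex ℝ E)
    (hα : ∀ b, α b = ∑ a, (μ a * modifiedRates r f a b - μ b * modifiedRates r f b a))
    {Ps P : ∀ T : ℝ, Measure (PathSpace E T)}
    (hPs : ∀ T, 0 < T → IsMarkovLaw (modifiedRates r f) μ T (Ps T))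
    (hP : ∀ T, 0 < T → IsMarkovLaw r μ T (P T)) :
    ∃ C δ : ℝ, 0 ≤ C ∧ 0 < δ ∧ ∀ T, 0 < T → T ≤ δ →
      |(InformationTheory.klDiv (Ps T) (P T)).toReal
        - T * (∑ a, f a * α a - hamiltonian r μ f)| ≤ C * T ^ 2 := by
  set rs := modifiedRates r f with hrs
  have hO : ∀ a, (fun t => (μ ᵥ* transition rs t) a - μ a - t * α a)
      =O[𝓝 0] fun t : ℝ => t ^ 2 := by
    intro a
    refine isBigO_sq_of_analyticAt ?_ (by simp) ?_
    · have h1 : AnalyticAt ℝ (fun t => (μ ᵥ* transition rs t) a) 0 := by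
        simp only [Matrix.vecMul, dotProduct]
        exact Finset.analyticAt_fun_sum _ fun c _ =>
          analyticAt_const.mul (analyticAt_transition_apply rs 0 c a)
      exact (h1.sub analyticAt_const).sub (analyticAt_id.mul analyticAt_const)
    · have h1 := hasDerivAt_pi.1 (hasDerivAt_vecMul_transition hα) a
      have h2 := (h1.sub_const (μ a)).sub ((hasDerivAt_id (0 : ℝ)).mul_const (α a))
      exact h2.congr_deriv (by simp)
  obtain ⟨C, δ, hC, hδ, hb⟩ := exists_uniform_abs_le_sq hO
  -- For `t ≤ T ≤ 1` the marginal moves by at most `C t² + t |α a| ≤ (C + |α a|) T`; this is also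
  -- why the time horizon is capped at `1`.
  set K : ℝ := ∑ a, (C + |α a|) * |potential r f a| with hK
  have hK0 : 0 ≤ K := Finset.sum_nonneg fun a _ => by positivity
  refine ⟨∑ a, |f a| * C + K, min δ 1, by positivity, by positivity, fun T hT hTδ => ?_⟩
  have hTδ' : T ≤ δ := hTδ.trans (min_le_left _ _)
  have hT1 : T ≤ 1 := hTδ.trans (min_le_right _ _)
  have hocc := (hPs T hT).abs_integral_occupationTime_sub_le (modifiedRates_nonneg hr f) hμ hT
    (potential r f) (B := K * T) (by
      rintro t ⟨ht0, htT⟩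
      rw [← Finset.sum_sub_distrib, hK, Finset.sum_mul]
      refine (Finset.abs_sum_le_sum_abs _ _).trans (Finset.sum_le_sum fun a _ => ?_)
      rw [← sub_mul, abs_mul, mul_right_comm]
      refine mul_le_mul_of_nonneg_right ?_ (abs_nonneg _)
      have h1 := hb a t (by rw [abs_of_nonneg ht0]; linarith)
      have h2 : |(μ ᵥ* transition rs t) a - μ a| ≤ C * t ^ 2 + t * |α a| := by
        have := abs_add_le ((μ ᵥ* transition rs t) a - μ a - t * α a) (t * α a)
        rw [sub_add_cancel, abs_mul, abs_of_nonneg ht0] at this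
        linarith
      have h3 : C * t ^ 2 ≤ C * T := by
        refine mul_le_mul_of_nonneg_left ?_ hC
        nlinarith
      have h4 : t * |α a| ≤ T * |α a| := mul_le_mul_of_nonneg_right htT (abs_nonneg _)
      refine h2.trans ?_
      linarith)
  rw [sum_mul_potential] at hocc
  rw [(hP T hT).toReal_klDiv hr hμ hT (hPs T hT)]
  have hlin : |∑ a, f a * ((μ ᵥ* transition rs T) a - μ a) - T * ∑ a, f a * α a|
      ≤ (∑ a, |f a| * C) * T ^ 2 := by
    rw [Finset.mul_sum, ← Finset.sum_sub_distrib, Finset.sum_mul]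
    refine (Finset.abs_sum_le_sum_abs _ _).trans (Finset.sum_le_sum fun a _ => ?_)
    have e : f a * ((μ ᵥ* transition rs T) a - μ a) - T * (f a * α a)
        = f a * ((μ ᵥ* transition rs T) a - μ a - T * α a) := by ring
    rw [e, abs_mul, mul_assoc]
    exact mul_le_mul_of_nonneg_left (hb a T (by rw [abs_of_pos hT]; exact hTδ')) (abs_nonneg _)
  rw [abs_le] at hlin hocc ⊢
  constructor <;> nlinarith [hlin.1, hlin.2, hocc.1, hocc.2]

end Entropy

/-! ### Construction of the discrete-time chain. -/

section DiscreteChain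

/-- `F` depends on the first `k + 1` coordinates only. -/
def DependsUpTo {E : Type*} (k : ℕ) (F : (ℕ → E) → ℝ≥0∞) : Prop :=
  ∀ x y : ℕ → E, (∀ j ≤ k, x j = y j) → F x = F y

lemma DependsUpTo.update {E : Type*} {k l : ℕ} {F : (ℕ → E) → ℝ≥0∞}
    (hF : DependsUpTo k F) (hkl : k ≤ l) (x : ℕ → E) (b : E) : F (Function.update x (l + 1) b) = F x :=
  hF _ _ fun j hj => Function.update_of_ne (by omega) _ _

variable {E : Type*} [Fintype E] [MeasurableSpace (ℕ → E)]

/-- The law of the first `k` steps of the chain with initial distribution `μ` and transition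
matrix `p`. -/
noncomputable def chainLaw (μ : E → ℝ) (p : Matrix E E ℝ) : ℕ → Measure (ℕ → E)
  | 0 => ∑ a, ENNReal.ofReal (μ a) • Measure.dirac fun _ => a
  | k + 1 => (chainLaw μ p k).bind fun x =>
      ∑ b, ENNReal.ofReal (p (x k) b) • Measure.dirac (Function.update x (k + 1) b)

-- All subsets are measurable; this is harmless, since each `chainLaw μ p k` is carried by finitely
-- many sequences.
variable [DiscreteMeasurableSpace (ℕ → E)] {μ : E → ℝ} {p : Matrix E E ℝ}

lemma lintegral_chainLaw_zero (F : (ℕ → E) → ℝ≥0∞) :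
    ∫⁻ x, F x ∂(chainLaw μ p 0) = ∑ a, ENNReal.ofReal (μ a) * F fun _ => a := by
  simp only [chainLaw, lintegral_finsetSum_measure, lintegral_smul_measure,
    lintegral_dirac' _ (Measurable.of_discrete (f := F)), smul_eq_mul]

lemma lintegral_chainLaw_succ (k : ℕ) (F : (ℕ → E) → ℝ≥0∞) :
    ∫⁻ x, F x ∂(chainLaw μ p (k + 1)) =
      ∫⁻ x, ∑ b, ENNReal.ofReal (p (x k) b) * F (Function.update x (k + 1) b)
        ∂(chainLaw μ p k) := by
  rw [chainLaw, Measure.lintegral_bind Measurable.of_discrete.aemeasurable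
    Measurable.of_discrete.aemeasurable]
  simp only [lintegral_finsetSum_measure, lintegral_smul_measure,
    lintegral_dirac' _ (Measurable.of_discrete (f := F)), smul_eq_mul]

lemma lintegral_chainLaw_of_le (hp0 : ∀ a b, 0 ≤ p a b) (hp : ∀ a, ∑ b, p a b = 1) {k l : ℕ}
    (hkl : k ≤ l) {F : (ℕ → E) → ℝ≥0∞} (hF : DependsUpTo k F) :
    ∫⁻ x, F x ∂(chainLaw μ p l) = ∫⁻ x, F x ∂(chainLaw μ p k) := by
  induction l, hkl using Nat.le_induction with
  | base => rfl
  | succ l hkl ih =>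
    rw [lintegral_chainLaw_succ, ← ih]
    refine lintegral_congr fun x => ?_
    simp only [hF.update hkl]
    rw [← Finset.sum_mul, ← ENNReal.ofReal_sum_of_nonneg fun b _ => hp0 _ b, hp,
      ENNReal.ofReal_one, one_mul]

/-- The Markov property of the discrete chain. -/
lemma lintegral_chainLaw_add [DecidableEq E] (hp0 : ∀ a b, 0 ≤ p a b)
    {k l j : ℕ} (hj : j = k + l) {F : (ℕ → E) → ℝ≥0∞} (hF : DependsUpTo k F) (c : E)
    (A : Matrix E E ℝ) (hA : ∀ a b, 0 ≤ A a b) :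
    ∫⁻ x, F x * ENNReal.ofReal (A (x j) c) ∂(chainLaw μ p j) =
      ∫⁻ x, F x * ENNReal.ofReal ((p ^ l * A) (x k) c) ∂(chainLaw μ p k) := by
  subst hj
  -- The matrix varies in the induction because each step of the chain is absorbed into it.
  induction l generalizing A with
  | zero => simp
  | succ l ih =>
    rw [← Nat.add_assoc, lintegral_chainLaw_succ, pow_succ, Matrix.mul_assoc, ← ih (p * A)
      fun a b => by
        rw [Matrix.mul_apply]
        exact Finset.sum_nonneg fun d _ => mul_nonneg (hp0 a d) (hA d b)]
    refine lintegral_congr fun x => ?_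
    simp only [hF.update (Nat.le_add_right k l), Function.update_self]
    rw [Matrix.mul_apply,
      ENNReal.ofReal_sum_of_nonneg fun b _ => mul_nonneg (hp0 _ b) (hA b c), Finset.mul_sum]
    refine Finset.sum_congr rfl fun b _ => ?_
    rw [ENNReal.ofReal_mul (hp0 _ b)]
    ring

/-- Induction on the number of times: the indicator of the last constraint is an entry of the
identity matrix, and the Markov property turns it into an entry of a power of `p`. -/
lemma lintegral_chainLaw_cylinder [DecidableEq E] (hμ : ∀ a, 0 ≤ μ a)
    (hp0 : ∀ a b, 0 ≤ p a b) (hp : ∀ a, ∑ b, p a b = 1)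
    (m : ℕ) (k : Fin (m + 1) → ℕ) (hk : Monotone k) (y : Fin (m + 1) → E) (n : ℕ)
    (hn : k (Fin.last m) ≤ n) :
    ∫⁻ x, (if ∀ i, x (k i) = y i then 1 else 0) ∂(chainLaw μ p n) =
      ENNReal.ofReal ((μ ᵥ* p ^ k 0) (y 0) *
        ∏ i : Fin m, (p ^ (k i.succ - k i.castSucc)) (y i.castSucc) (y i.succ)) := by
  have hpow : ∀ l a b, 0 ≤ (p ^ l) a b := by
    intro l
    induction l with
    | zero => intro a b; simp only [pow_zero, Matrix.one_apply]; split_ifs <;> norm_num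
    | succ l ih =>
      intro a b
      rw [pow_succ, Matrix.mul_apply]
      exact Finset.sum_nonneg fun c _ => mul_nonneg (ih a c) (hp0 c b)
  have hone : ∀ a b, 0 ≤ (1 : Matrix E E ℝ) a b := hpow 0
  have hdep : ∀ (m : ℕ) (k : Fin (m + 1) → ℕ) (_ : Monotone k) (y : Fin (m + 1) → E),
      DependsUpTo (k (Fin.last m)) fun x : ℕ → E => if ∀ i, x (k i) = y i then 1 else 0 := by
    intro m k hk y x x' hx
    refine if_congr (forall_congr' fun i => ?_) rfl rfl
    rw [hx _ (hk (Fin.le_last i))]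
  rw [lintegral_chainLaw_of_le hp0 hp hn (hdep m k hk y)]
  clear hn n
  induction m with
  | zero =>
    have h := lintegral_chainLaw_add (μ := μ) hp0 (zero_add (k 0)).symm (F := fun _ => 1)
      (fun _ _ _ => rfl) (y 0) 1 hone
    rw [lintegral_chainLaw_zero] at h
    simp only [one_mul, mul_one] at h
    have e : ∀ x : ℕ → E, (if ∀ i : Fin 1, x (k i) = y i then (1 : ℝ≥0∞) else 0)
        = ENNReal.ofReal ((1 : Matrix E E ℝ) (x (k 0)) (y 0)) := by
      intro x
      simp only [Fin.forall_fin_one, Matrix.one_apply]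
      split_ifs <;> simp
    simp only [e, Finset.univ_eq_empty, Finset.prod_empty, mul_one]
    refine h.trans ?_
    rw [Matrix.vecMul, dotProduct,
      ENNReal.ofReal_sum_of_nonneg fun c _ => mul_nonneg (hμ c) (hpow _ c _)]
    exact Finset.sum_congr rfl fun c _ => (ENNReal.ofReal_mul (hμ c)).symm
  | succ m ih =>
    set k' : Fin (m + 1) → ℕ := fun i => k i.castSucc with hk'
    set y' : Fin (m + 1) → E := fun i => y i.castSucc with hy'
    have hkm' : Monotone k' := fun i j hij => hk (Fin.castSucc_le_castSucc_iff.2 hij)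
    have hle : k' (Fin.last m) ≤ k (Fin.last (m + 1)) := hk (Fin.le_last _)
    obtain ⟨l, hl⟩ := Nat.exists_eq_add_of_le hle
    have h := lintegral_chainLaw_add (μ := μ) hp0 hl (hdep m k' hkm' y')
      (y (Fin.last (m + 1))) 1 hone
    have e : ∀ x : ℕ → E, (if ∀ i, x (k i) = y i then (1 : ℝ≥0∞) else 0)
        = (if ∀ i, x (k' i) = y' i then 1 else 0) * ENNReal.ofReal
          ((1 : Matrix E E ℝ) (x (k (Fin.last (m + 1)))) (y (Fin.last (m + 1)))) := by
      intro x
      simp only [Fin.forall_fin_succ', Matrix.one_apply, hk', hy']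
      by_cases h1 : (∀ i : Fin m, x (k i.castSucc.castSucc) = y i.castSucc.castSucc) ∧
          x (k (Fin.last m).castSucc) = y (Fin.last m).castSucc <;>
        by_cases h2 : x (k (Fin.last (m + 1))) = y (Fin.last (m + 1)) <;> simp [h1, h2]
    simp only [e]
    rw [h, mul_one]
    have e2 : ∀ x : ℕ → E, (if ∀ i, x (k' i) = y' i then (1 : ℝ≥0∞) else 0) *
          ENNReal.ofReal ((p ^ l) (x (k' (Fin.last m))) (y (Fin.last (m + 1))))
        = (if ∀ i, x (k' i) = y' i then 1 else 0) *
          ENNReal.ofReal ((p ^ l) (y' (Fin.last m)) (y (Fin.last (m + 1)))) := by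
      intro x
      split_ifs with hx
      · rw [hx]
      · simp
    simp only [e2]
    rw [lintegral_mul_const _ Measurable.of_discrete, ih k' hkm' y', ← ENNReal.ofReal_mul,
      Fin.prod_univ_castSucc, ← mul_assoc]
    · have hl' : k (Fin.last m).succ - k (Fin.last m).castSucc = l := by
        rw [Fin.succ_last, hl]
        exact Nat.add_sub_cancel_left _ _
      rw [hl']
      rfl
    · refine mul_nonneg (Finset.sum_nonneg fun c _ => mul_nonneg (hμ c) (hpow _ _ _))
        (Finset.prod_nonneg fun i _ => hpow _ _ _)

end DiscreteChain

/-- Finite-dimensional distributions of the discrete chain. -/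
lemma exists_discreteChain {E : Type*} [Fintype E] [DecidableEq E] {μ : E → ℝ}
    (hμ : μ ∈ stdSimplex ℝ E) {p : Matrix E E ℝ} (hp0 : ∀ a b, 0 ≤ p a b)
    (hp : ∀ a, ∑ b, p a b = 1) (n : ℕ) :
    ∃ M : @Measure (ℕ → E) ⊤, M Set.univ = 1 ∧
      ∀ (m : ℕ) (k : Fin (m + 1) → ℕ), Monotone k → k (Fin.last m) ≤ n → ∀ y : Fin (m + 1) → E,
        M {x | ∀ i, x (k i) = y i} = ENNReal.ofReal ((μ ᵥ* p ^ k 0) (y 0) *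
          ∏ i : Fin m, (p ^ (k i.succ - k i.castSucc)) (y i.castSucc) (y i.succ)) := by
  let _ : MeasurableSpace (ℕ → E) := ⊤
  have : DiscreteMeasurableSpace (ℕ → E) := ⟨fun _ => trivial⟩
  refine ⟨chainLaw μ p n, ?_, fun m k hk hn y => ?_⟩
  · have h := lintegral_chainLaw_of_le (μ := μ) hp0 hp (Nat.zero_le n)
      (F := fun _ : ℕ → E => 1) fun _ _ _ => rfl
    rw [lintegral_chainLaw_zero] at h
    simp only [lintegral_one, mul_one] at h
    rw [h, ← ENNReal.ofReal_sum_of_nonneg fun a _ => hμ.1 a, hμ.2, ENNReal.ofReal_one]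
  · rw [← lintegral_chainLaw_cylinder hμ.1 hp0 hp m k hk y n hn]
    have e : (fun x : ℕ → E => if ∀ i, x (k i) = y i then (1 : ℝ≥0∞) else 0)
        = Set.indicator {x | ∀ i, x (k i) = y i} 1 := by
      funext x
      simp [Set.indicator_apply]
    rw [e, lintegral_indicator_one (MeasurableSet.of_discrete)]

/-! ### Variation along factorial grids. -/

section Variation

/-- Reason for steps `1/n!`: these grids are nested, and every nonnegative rational is a grid point
as soon as its denominator is at most `n`. -/
lemma floor_mul_factorial {q : ℚ} (hq : 0 ≤ q) {n : ℕ} (hn : q.den ≤ n) :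
    ((⌊q * n.factorial⌋₊ : ℕ) : ℚ) = q * n.factorial := by
  obtain ⟨d, hd⟩ := Nat.dvd_factorial q.pos hn
  have hnum : (q.num.toNat : ℚ) = q.num := by
    have : ((q.num.toNat : ℤ)) = q.num := Int.toNat_of_nonneg (Rat.num_nonneg.2 hq)
    exact_mod_cast this
  have e : q * n.factorial = ((q.num.toNat * d : ℕ) : ℚ) := by
    rw [hd]
    push_cast
    rw [hnum, ← mul_assoc, Rat.mul_den_eq_num]
  rw [e, Nat.floor_natCast]

variable {E : Type*} [Fintype E]

/-- The variation over a bounded rational interval is approximated by those over fine grids. -/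
lemma eVariationOn_rat_le (g : ℚ → ℕ) (m : ℕ) :
    eVariationOn g (Set.Icc 0 (m : ℚ)) ≤ ⨆ n : ℕ,
      eVariationOn g ((fun i : ℕ => (i : ℚ) / n.factorial) '' Set.Iic (m * n.factorial)) := by
  refine iSup_le fun p => ?_
  obtain ⟨k, u, hu, hus⟩ := p
  -- The sum dominates every denominator, so all points of the partition lie on the grid of step
  -- `1/n!`.
  set n := ∑ i ∈ Finset.range (k + 1), (u i).den with hn
  have hden : ∀ i ≤ k, (u i).den ≤ n := fun i hi =>
    Finset.single_le_sum (f := fun i => (u i).den) (fun _ _ => Nat.zero_le _)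
      (Finset.mem_range.2 (Nat.lt_succ_of_le hi))
  refine le_trans ?_ (le_iSup _ n)
  refine eVariationOn.sum_le_of_monotoneOn_Iic (fun i _ j _ hij => hu hij) fun i hi => ?_
  have hk := floor_mul_factorial (hus i).1 (hden i hi)
  have hpos : (0 : ℚ) < n.factorial := by exact_mod_cast n.factorial_pos
  refine ⟨⌊u i * n.factorial⌋₊, ?_, ?_⟩
  · refine Nat.floor_le_of_le ?_
    push_cast
    exact mul_le_mul_of_nonneg_right (hus i).2 hpos.le
  · simp only
    rw [hk, mul_div_cancel_right₀ _ hpos.ne']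

/-- The values of the chain as natural numbers. -/
noncomputable def label (a : E) : ℕ := Fintype.equivFin E a

lemma label_injective : Function.Injective (label : E → ℕ) :=
  Fin.val_injective.comp (Fintype.equivFin E).injective

lemma edist_label_le [DecidableEq E] (a b : E) :
    edist (label a) (label b) ≤ if a = b then 0 else (Fintype.card E : ℝ≥0∞) := by
  split_ifs with h
  · simp [h]
  · rw [edist_dist, Nat.dist_eq]
    refine ENNReal.ofReal_le_of_le_toReal ?_
    have h1 : (label a : ℝ) ≤ Fintype.card E := by exact_mod_cast (Fintype.equivFin E a).2.le
    have h2 : (label b : ℝ) ≤ Fintype.card E := by exact_mod_cast (Fintype.equivFin E b).2.le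
    have h3 : (0 : ℝ) ≤ label a := Nat.cast_nonneg _
    have h4 : (0 : ℝ) ≤ label b := Nat.cast_nonneg _
    rw [ENNReal.toReal_natCast, abs_le]
    constructor <;> linarith

variable [MeasurableSpace E]

/-- The set of functions with bounded variation along fine grids. -/
def regularSet (E : Type*) [Fintype E] (m : ℕ) : Set (ℚ → E) :=
  {ω | ⨆ n : ℕ, eVariationOn (fun q => label (ω q))
    ((fun i : ℕ => (i : ℚ) / n.factorial) '' Set.Iic (m * n.factorial)) < ∞}

lemma grid_monotone (n : ℕ) : Monotone fun i : ℕ => (i : ℚ) / n.factorial := fun i j hij => by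
  have : (i : ℚ) ≤ j := by exact_mod_cast hij
  simp only
  gcongr

lemma measurable_edist_label [MeasurableSingletonClass E] (q q' : ℚ) :
    Measurable fun ω : ℚ → E => edist (label (ω q)) (label (ω q')) := by
  have h : Measurable (label : E → ℕ) := measurable_of_countable _
  exact (h.comp (measurable_pi_apply q)).edist (h.comp (measurable_pi_apply q'))

lemma measurable_grid_variation [MeasurableSingletonClass E] (m n : ℕ) :
    Measurable fun ω : ℚ → E => eVariationOn (fun q => label (ω q))
      ((fun i : ℕ => (i : ℚ) / n.factorial) '' Set.Iic (m * n.factorial)) := by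
  simp only [eVariationOn.image_range_of_monotone _ (grid_monotone n)]
  exact Finset.measurable_sum _ fun i _ => measurable_edist_label _ _

lemma measurableSet_regularSet [MeasurableSingletonClass E] (m : ℕ) :
    MeasurableSet (regularSet E m) :=
  measurableSet_lt (Measurable.iSup fun n => measurable_grid_variation m n) measurable_const

end Variation

/-! ### The chain on the rational times. -/

section RationalTimes

variable {E : Type*} [Fintype E] [DecidableEq E] {r : E → E → ℝ} {μ : E → ℝ}

/-- The finite-dimensional distributions of the chain on the rational times. -/
def IsRationalLaw [MeasurableSpace E] (r : E → E → ℝ) (μ : E → ℝ) (Q : Measure (ℚ → E)) : Prop :=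
  ∀ (m : ℕ) (q : Fin (m + 1) → ℚ), Monotone q → 0 ≤ q 0 → ∀ y : Fin (m + 1) → E,
    Q {ω | ∀ i, ω (q i) = y i} = ENNReal.ofReal ((μ ᵥ* transition r (q 0)) (y 0) *
      ∏ i : Fin m, transition r (q i.succ - q i.castSucc) (y i.castSucc) (y i.succ))

/-- The chain with the given rates exists on all nonnegative rational times. -/
lemma exists_rationalLaw [TopologicalSpace E] [DiscreteTopology E] [MeasurableSpace E]
    [BorelSpace E] (hr : ∀ a b, a ≠ b → 0 ≤ r a b) (hμ : μ ∈ stdSimplex ℝ E) :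
    ∃ Q : Measure (ℚ → E), IsProbabilityMeasure Q ∧ IsRationalLaw r μ Q := by
  have hpos : ∀ n : ℕ, (0 : ℝ) < n.factorial := fun n => by exact_mod_cast n.factorial_pos
  choose M hM1 hM using fun n : ℕ => exists_discreteChain hμ
    (transition_nonneg hr (t := 1 / n.factorial) (by have := hpos n; positivity))
    (sum_transition r _) (n * n.factorial)
  let π : ∀ n : ℕ, (ℕ → E) → ℚ → E := fun n x q => x ⌊q * n.factorial⌋₊
  let L : ℕ → ProbabilityMeasure (ℚ → E) := fun n =>
    ⟨@Measure.map _ _ ⊤ _ (π n) (M n), ⟨by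
      rw [@Measure.map_apply _ _ ⊤ _ _ _ measurable_from_top _ MeasurableSet.univ,
        Set.preimage_univ, hM1]⟩⟩
  -- Probability measures on the compact space `ℚ → E` form a compact space, so an ultrafilter limit
  -- exists and no subsequence has to be chosen.
  let U : Ultrafilter (ProbabilityMeasure (ℚ → E)) := (hyperfilter ℕ).map L
  have hU : Tendsto L (hyperfilter ℕ) (𝓝 U.lim) := U.le_nhds_lim
  refine ⟨U.lim, inferInstance, fun m q hq hq0 y => ?_⟩
  set A : Set (ℚ → E) := {ω | ∀ i, ω (q i) = y i} with hA
  have hAe : A = ⋂ i, (fun ω : ℚ → E => ω (q i)) ⁻¹' {y i} := by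
    ext ω; simp [hA]
  -- Clopen events have empty frontier, so weak convergence preserves their probabilities; these are
  -- already constant for large `n`.
  have hclopen : IsClopen A := by
    rw [hAe]
    exact isClopen_iInter_of_finite fun i => (isClopen_discrete _).preimage (continuous_apply _)
  have hlim : Tendsto (fun n => (L n : Measure (ℚ → E)) A) (hyperfilter ℕ)
      (𝓝 ((U.lim : Measure (ℚ → E)) A)) :=
    ProbabilityMeasure.tendsto_measure_of_null_frontier_of_tendsto' hU
      (by rw [hclopen.frontier_eq, measure_empty])
  refine tendsto_nhds_unique hlim (tendsto_const_nhds.congr' ?_)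
  have hev : ∀ᶠ n : ℕ in atTop, (∀ i, (q i).den ≤ n) ∧ q (Fin.last m) ≤ n := by
    refine (eventually_all.2 fun i => eventually_ge_atTop _).and ?_
    exact (tendsto_natCast_atTop_atTop (R := ℚ)).eventually_ge_atTop _
  have hev' : ∀ᶠ n : ℕ in hyperfilter ℕ, (∀ i, (q i).den ≤ n) ∧ q (Fin.last m) ≤ n := by
    refine Filter.Eventually.filter_mono ?_ hev
    rw [← Nat.cofinite_eq_atTop]
    exact hyperfilter_le_cofinite
  filter_upwards [hev'] with n ⟨hn, hlast⟩
  have hq' : ∀ i, 0 ≤ q i := fun i => hq0.trans (hq (Fin.zero_le i))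
  have hk : ∀ i, ((⌊q i * n.factorial⌋₊ : ℕ) : ℚ) = q i * n.factorial :=
    fun i => floor_mul_factorial (hq' i) (hn i)
  have hkr : ∀ i, ((⌊q i * n.factorial⌋₊ : ℕ) : ℝ) = q i * n.factorial := fun i => by
    exact_mod_cast congrArg (fun x : ℚ => (x : ℝ)) (hk i)
  have hkm : Monotone fun i => ⌊q i * n.factorial⌋₊ := fun i j hij =>
    Nat.floor_mono (mul_le_mul_of_nonneg_right (hq hij) (by positivity))
  have hle : ⌊q (Fin.last m) * n.factorial⌋₊ ≤ n * n.factorial := by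
    refine Nat.floor_le_of_le ?_
    push_cast
    exact mul_le_mul_of_nonneg_right hlast (by positivity)
  have hp : ∀ k : ℕ, transition r (1 / n.factorial) ^ k = transition r (k * (1 / n.factorial)) :=
    fun k => (transition_nsmul r k _).symm
  have hA' : @Measure.map _ _ ⊤ _ (π n) (M n) A = M n {x | ∀ i, x ⌊q i * n.factorial⌋₊ = y i} :=
    @Measure.map_apply _ _ ⊤ _ _ _ measurable_from_top _ hclopen.2.measurableSet
  change _ = @Measure.map _ _ ⊤ _ (π n) (M n) A
  rw [hA', hM n m _ hkm hle y]
  have hne := (hpos n).ne'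
  congr 2
  · rw [hp, hkr, mul_assoc, mul_one_div_cancel hne, mul_one]
  · refine Finset.prod_congr rfl fun i _ => ?_
    rw [hp, Nat.cast_sub (hkm (Fin.castSucc_lt_succ.le)), hkr, hkr, ← sub_mul, mul_assoc,
      mul_one_div_cancel hne, mul_one]

/-- Off-diagonal transition probabilities are at most linear in short times. -/
lemma exists_transition_le (r : E → E → ℝ) :
    ∃ C δ : ℝ, 0 ≤ C ∧ 0 < δ ∧ ∀ h, 0 ≤ h → h ≤ δ → ∀ c d, c ≠ d → transition r h c d ≤ C * h := by
  have hO : ∀ i : E × E, (fun h => transition r h i.1 i.2 - (1 : Matrix E E ℝ) i.1 i.2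
      - h * generatorMatrix r i.1 i.2) =O[𝓝 0] fun t : ℝ => t ^ 2 := by
    rintro ⟨c, d⟩
    refine isBigO_sq_of_analyticAt ?_ (by simp) ?_
    · exact ((analyticAt_transition_apply r 0 c d).sub analyticAt_const).sub
        (analyticAt_id.mul analyticAt_const)
    · exact (((hasDerivAt_transition_apply_zero r c d).sub_const _).sub
        ((hasDerivAt_id (0 : ℝ)).mul_const _)).congr_deriv (by simp)
  obtain ⟨C, δ, hC, hδ, hb⟩ := exists_uniform_abs_le_sq hO
  set B : ℝ := ∑ i : E × E, |generatorMatrix r i.1 i.2| with hB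
  have hB0 : 0 ≤ B := Finset.sum_nonneg fun _ _ => abs_nonneg _
  -- For `h ≤ δ` the quadratic remainder satisfies `C h² ≤ C δ h`.
  refine ⟨C * δ + B, δ, by positivity, hδ, fun h h0 hhδ c d hcd => ?_⟩
  have h1 := hb (c, d) h (by rwa [abs_of_nonneg h0])
  have h2 : |generatorMatrix r c d| ≤ B :=
    Finset.single_le_sum (f := fun i : E × E => |generatorMatrix r i.1 i.2|)
      (fun _ _ => abs_nonneg _) (Finset.mem_univ (c, d))
  simp only [Matrix.one_apply_ne hcd, sub_zero] at h1
  have h3 := (le_abs_self _).trans h1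
  have h4 : h * generatorMatrix r c d ≤ h * B :=
    mul_le_mul_of_nonneg_left ((le_abs_self _).trans h2) h0
  have h5 : C * h ^ 2 ≤ C * δ * h := by
    rw [sq, ← mul_assoc, mul_assoc C δ h, mul_comm δ h, ← mul_assoc]
    exact mul_le_mul_of_nonneg_left hhδ (by positivity)
  linarith

variable [MeasurableSpace E] {Q : Measure (ℚ → E)}

lemma IsRationalLaw.measure_pair_le (hQ : IsRationalLaw r μ Q)
    (hr : ∀ a b, a ≠ b → 0 ≤ r a b) (hμ : μ ∈ stdSimplex ℝ E) {q q' : ℚ} (hq : 0 ≤ q)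
    (hqq : q ≤ q') (c d : E) :
    Q {ω | ω q = c ∧ ω q' = d} ≤ ENNReal.ofReal (transition r (q' - q) c d) := by
  have h := hQ 1 ![q, q'] (by
    rw [Fin.monotone_iff_le_succ]
    intro i
    fin_cases i
    exact hqq) hq ![c, d]
  have e : {ω : ℚ → E | ∀ i, ω ((![q, q'] : Fin 2 → ℚ) i) = (![c, d] : Fin 2 → E) i}
      = {ω | ω q = c ∧ ω q' = d} := by
    ext ω; simp [Fin.forall_fin_two]
  rw [e] at h
  rw [h]
  have hqr : (0 : ℝ) ≤ q := by exact_mod_cast hq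
  have hqr' : (0 : ℝ) ≤ q' - q := by
    have : (q : ℝ) ≤ q' := by exact_mod_cast hqq
    linarith
  refine ENNReal.ofReal_le_ofReal ?_
  have h1 := sum_vecMul_transition (r := r) hμ.2 q
  have h2 : (μ ᵥ* transition r q) c ≤ 1 := by
    rw [← h1]
    exact Finset.single_le_sum (f := fun a => (μ ᵥ* transition r q) a)
      (fun a _ => vecMul_transition_nonneg hr hμ.1 hqr a) (Finset.mem_univ c)
  simpa using mul_le_of_le_one_left (transition_nonneg hr hqr' c d) h2

/-- Only pairs `c ≠ d` contribute, each with label distance at most the number of states. -/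
lemma IsRationalLaw.lintegral_edist_le [MeasurableSingletonClass E] (hQ : IsRationalLaw r μ Q)
    (hr : ∀ a b, a ≠ b → 0 ≤ r a b) (hμ : μ ∈ stdSimplex ℝ E) {q q' : ℚ} (hq : 0 ≤ q)
    (hqq : q ≤ q') {B : ℝ} (hB : ∀ c d, c ≠ d → transition r (q' - q) c d ≤ B) :
    ∫⁻ ω, edist (label (ω q)) (label (ω q')) ∂Q
      ≤ Fintype.card E * (Fintype.card E * (Fintype.card E * ENNReal.ofReal B)) := by
  have hm1 : ∀ q c, MeasurableSet {ω : ℚ → E | ω q = c} := fun q c =>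
    measurableSet_eq_fun (measurable_pi_apply q) measurable_const
  have hm : ∀ c d, MeasurableSet {ω : ℚ → E | ω q = c ∧ ω q' = d} := fun c d =>
    (hm1 q c).inter (hm1 q' d)
  calc ∫⁻ ω, edist (label (ω q)) (label (ω q')) ∂Q
      ≤ ∫⁻ ω, ∑ c, ∑ d, Set.indicator {ω : ℚ → E | ω q = c ∧ ω q' = d}
          (fun _ => if c = d then 0 else (Fintype.card E : ℝ≥0∞)) ω ∂Q := by
        refine lintegral_mono fun ω => ?_
        refine (edist_label_le _ _).trans (le_of_eq ?_)
        simp [Set.indicator_apply, ite_and]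
    _ = ∑ c, ∑ d, (if c = d then 0 else (Fintype.card E : ℝ≥0∞))
          * Q {ω : ℚ → E | ω q = c ∧ ω q' = d} := by
        rw [lintegral_finsetSum _ fun c _ => Finset.measurable_sum _ fun d _ =>
          measurable_const.indicator (hm c d)]
        refine Finset.sum_congr rfl fun c _ => ?_
        rw [lintegral_finsetSum _ fun d _ => measurable_const.indicator (hm c d)]
        refine Finset.sum_congr rfl fun d _ => ?_
        rw [lintegral_indicator (hm c d), setLIntegral_const]
    _ ≤ ∑ _c : E, ∑ _d : E, (Fintype.card E : ℝ≥0∞) * ENNReal.ofReal B := by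
        refine Finset.sum_le_sum fun c _ => Finset.sum_le_sum fun d _ => ?_
        split_ifs with hcd
        · simp
        · gcongr
          exact (hQ.measure_pair_le hr hμ hq hqq c d).trans
            (ENNReal.ofReal_le_ofReal (hB c d hcd))
    _ = _ := by
        simp only [Finset.sum_const, Finset.card_univ, nsmul_eq_mul]

/-- The grid has `m n!` cells with expected increment `O(1/n!)` each, so the expected variation is
bounded in `n`. It increases along nested grids, and monotone convergence makes the supremum
integrable. -/
lemma IsRationalLaw.ae_mem_regularSet [MeasurableSingletonClass E] (hQ : IsRationalLaw r μ Q)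
    (hr : ∀ a b, a ≠ b → 0 ≤ r a b) (hμ : μ ∈ stdSimplex ℝ E) (m : ℕ) :
    ∀ᵐ ω ∂Q, ω ∈ regularSet E m := by
  obtain ⟨C, δ, hC, hδ, hb⟩ := exists_transition_le r
  obtain ⟨n₀, hn₀⟩ := exists_nat_gt (1 / δ)
  set N : ℝ≥0∞ := (Fintype.card E : ℝ≥0∞) with hN
  have hmono : Monotone fun (n : ℕ) (ω : ℚ → E) => eVariationOn (fun q => label (ω q))
      ((fun i : ℕ => (i : ℚ) / n.factorial) '' Set.Iic (m * n.factorial)) := by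
    intro n n' hnn ω
    refine eVariationOn.mono _ ?_
    rintro _ ⟨i, hi, rfl⟩
    obtain ⟨d, hd⟩ := Nat.factorial_dvd_factorial hnn
    have h1 : (n.factorial : ℚ) ≠ 0 := by exact_mod_cast n.factorial_ne_zero
    have h2 : (d : ℚ) ≠ 0 := by
      have := n'.factorial_ne_zero
      rw [hd] at this
      exact_mod_cast (Nat.mul_ne_zero_iff.1 this).2
    refine ⟨i * d, ?_, ?_⟩
    · rw [Set.mem_Iic] at hi ⊢
      rw [hd, ← mul_assoc]
      exact Nat.mul_le_mul_right d hi
    · simp only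
      rw [hd]
      push_cast
      field_simp
  have hbound : ∀ n, n₀ ≤ n → ∫⁻ ω, eVariationOn (fun q => label (ω q))
      ((fun i : ℕ => (i : ℚ) / n.factorial) '' Set.Iic (m * n.factorial)) ∂Q
      ≤ N * (N * (N * ENNReal.ofReal (m * C))) := by
    intro n hn
    have hpos : (0 : ℝ) < n.factorial := by exact_mod_cast n.factorial_pos
    have hstep : 1 / (n.factorial : ℝ) ≤ δ := by
      rw [div_le_iff₀ hpos]
      rw [div_lt_iff₀ hδ] at hn₀
      have : (n₀ : ℝ) ≤ n.factorial := by exact_mod_cast hn.trans n.self_le_factorial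
      nlinarith
    simp only [eVariationOn.image_range_of_monotone _ (grid_monotone n)]
    rw [lintegral_finsetSum _ fun i _ => measurable_edist_label _ _]
    calc _ ≤ ∑ _i ∈ Finset.range (m * n.factorial),
          N * (N * (N * ENNReal.ofReal (C * (1 / n.factorial)))) := by
          refine Finset.sum_le_sum fun i _ => ?_
          refine hQ.lintegral_edist_le hr hμ (by positivity) (grid_monotone n (Nat.le_succ i))
            fun c d hcd => ?_
          have e : ((((i + 1 : ℕ) : ℚ) / n.factorial : ℚ) : ℝ) - (((i : ℚ) / n.factorial : ℚ) : ℝ)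
              = 1 / n.factorial := by
            push_cast
            ring
          rw [e]
          exact hb _ (by positivity) hstep c d hcd
      _ = N * (N * (N * ENNReal.ofReal (m * C))) := by
          rw [Finset.sum_const, Finset.card_range, nsmul_eq_mul]
          have e : ENNReal.ofReal (m * C)
              = ((m * n.factorial : ℕ) : ℝ≥0∞) * ENNReal.ofReal (C * (1 / n.factorial)) := by
            rw [← ENNReal.ofReal_natCast, ← ENNReal.ofReal_mul (by positivity)]
            congr 1
            push_cast
            field_simp
          rw [e]
          ring
  refine ae_lt_top (Measurable.iSup fun n => measurable_grid_variation m n) ?_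
  rw [lintegral_iSup (fun n => measurable_grid_variation m n) hmono]
  refine ne_top_of_le_ne_top (b := N * (N * (N * ENNReal.ofReal (m * C)))) ?_
    (iSup_le fun n => ?_)
  · have hNt : N ≠ ∞ := ENNReal.natCast_ne_top _
    exact ENNReal.mul_ne_top hNt (ENNReal.mul_ne_top hNt
      (ENNReal.mul_ne_top hNt ENNReal.ofReal_ne_top))
  · exact (lintegral_mono (hmono (le_max_left n n₀))).trans (hbound _ (le_max_right _ _))

end RationalTimes

/-! ### Right-continuous versions with left limits. -/

section Regularization

variable {E : Type*} [Fintype E]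

/-- Moves to the real line, where bounded variation yields one-sided limits. The default value off
the rationals is invisible, as only rational points are used. -/
lemma boundedVariationOn_of_mem_regularSet {m : ℕ} {ω : ℚ → E} (h : ω ∈ regularSet E m) :
    BoundedVariationOn (Function.extend (fun q : ℚ => (q : ℝ)) (fun q => label (ω q)) fun _ => 0)
      ((fun q : ℚ => (q : ℝ)) '' Set.Icc 0 (m : ℚ)) := by
  have hm : Monotone fun q : ℚ => (q : ℝ) := Rat.cast_mono
  have hinj : Function.Injective fun q : ℚ => (q : ℝ) := Rat.cast_injective
  rw [BoundedVariationOn, ← eVariationOn.comp_eq_of_monotoneOn _ _ (hm.monotoneOn _),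
    Function.extend_comp hinj]
  exact ne_top_of_lt (lt_of_le_of_lt (eVariationOn_rat_le _ m) h)

lemma exists_right_value {m : ℕ} {ω : ℚ → E} (h : ω ∈ regularSet E m) {t : ℝ} (ht : 0 ≤ t)
    (htm : t < m) : ∃ a : E, ∃ δ > 0, ∀ q : ℚ, t < q → (q : ℝ) < t + δ → ω q = a := by
  have hinj : Function.Injective fun q : ℚ => (q : ℝ) := Rat.cast_injective
  obtain ⟨l, hl⟩ := (boundedVariationOn_of_mem_regularSet h).exists_tendsto_right t
  have hev := hl ((isOpen_discrete {l}).mem_nhds rfl)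
  rw [mem_map, mem_nhdsWithin_iff_exists_mem_nhds_inter] at hev
  obtain ⟨V, hV, hVs⟩ := hev
  obtain ⟨δ, hδ, hball⟩ := Metric.mem_nhds_iff.1 hV
  -- Labels are discrete, so convergence means local constancy; the minimum with `m - t` keeps the
  -- rationals in the controlled interval.
  have hlab : ∀ q : ℚ, t < q → (q : ℝ) < t + min δ (m - t) → label (ω q) = l := by
    intro q hq1 hq2
    have h1 : (q : ℝ) < t + δ := hq2.trans_le (by linarith [min_le_left δ (m - t)])
    have h2 : (q : ℝ) < m := hq2.trans_le (by linarith [min_le_right δ (m - t)])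
    have hmem := hVs ⟨hball (by
      rw [Metric.mem_ball, Real.dist_eq, abs_of_pos (by linarith)]; linarith),
      ⟨q, ⟨?_, ?_⟩, rfl⟩, hq1⟩
    · simpa [hinj.extend_apply] using hmem
    · exact_mod_cast (ht.trans hq1.le)
    · exact_mod_cast h2.le
  have hδ' : 0 < min δ (m - t) := lt_min hδ (by linarith)
  obtain ⟨q₀, hq1, hq2⟩ := exists_rat_btwn (show t < t + min δ (m - t) by linarith)
  exact ⟨ω q₀, _, hδ', fun q h1 h2 => label_injective ((hlab q h1 h2).trans (hlab q₀ hq1 hq2).symm)⟩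

lemma exists_left_value [Nonempty E] {m : ℕ} {ω : ℚ → E} (h : ω ∈ regularSet E m) {t : ℝ}
    (htm : t ≤ m) :
    ∃ a : E, ∃ δ > 0, ∀ q : ℚ, 0 ≤ q → t - δ < q → (q : ℝ) < t → ω q = a := by
  have hinj : Function.Injective fun q : ℚ => (q : ℝ) := Rat.cast_injective
  obtain ⟨l, hl⟩ := (boundedVariationOn_of_mem_regularSet h).exists_tendsto_left t
  have hev := hl ((isOpen_discrete {l}).mem_nhds rfl)
  rw [mem_map, mem_nhdsWithin_iff_exists_mem_nhds_inter] at hev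
  obtain ⟨V, hV, hVs⟩ := hev
  obtain ⟨δ, hδ, hball⟩ := Metric.mem_nhds_iff.1 hV
  have hlab : ∀ q : ℚ, 0 ≤ q → t - δ < q → (q : ℝ) < t → label (ω q) = l := by
    intro q hq0 hq1 hq2
    have hmem := hVs ⟨hball (by
      rw [Metric.mem_ball, Real.dist_eq, abs_of_neg (by linarith)]; linarith),
      ⟨q, ⟨hq0, ?_⟩, rfl⟩, hq2⟩
    · simpa [hinj.extend_apply] using hmem
    · exact_mod_cast hq2.le.trans htm
  -- For `t = 0` no nonnegative rational lies to the left, and any value serves.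
  by_cases hne : ∃ q : ℚ, 0 ≤ q ∧ t - δ < q ∧ (q : ℝ) < t
  · obtain ⟨q₀, h0, h1, h2⟩ := hne
    exact ⟨ω q₀, δ, hδ, fun q h0' h1' h2' =>
      label_injective ((hlab q h0' h1' h2').trans (hlab q₀ h0 h1 h2).symm)⟩
  · exact ⟨Classical.arbitrary E, δ, hδ, fun q h0 h1 h2 => absurd ⟨q, h0, h1, h2⟩ hne⟩

variable {T : ℝ} {m : ℕ}

open Classical in
/-- The right-continuous version of a function on the rational times. -/
noncomputable def rightVersion (hTm : T < m) (e : E) (ω : ℚ → E) (t : Set.Icc (0 : ℝ) T) : E :=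
  if h : ω ∈ regularSet E m then
    (exists_right_value h t.2.1 (t.2.2.trans_lt hTm)).choose else e

lemma rightVersion_spec (hTm : T < m) (e : E) {ω : ℚ → E} (h : ω ∈ regularSet E m)
    (t : Set.Icc (0 : ℝ) T) :
    ∃ δ > 0, ∀ q : ℚ, (t : ℝ) < q → (q : ℝ) < t + δ → ω q = rightVersion hTm e ω t := by
  rw [rightVersion, dif_pos h]
  exact (exists_right_value h t.2.1 (t.2.2.trans_lt hTm)).choose_spec

/-- The value at `s` is read at rationals just after `s`; for `s` close to `t` on one side these can
be taken in the window where the rational path is constant. -/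
lemma isCadlag_rightVersion (hTm : T < m) (e : E) (ω : ℚ → E) :
    IsCadlag (rightVersion hTm e ω) := by
  by_cases h : ω ∈ regularSet E m
  swap
  · have hc : rightVersion hTm e ω = fun _ => e := by
      funext t; rw [rightVersion, dif_neg h]
    rw [hc]
    exact fun t => ⟨Eventually.of_forall fun _ => rfl, e, Eventually.of_forall fun _ => rfl⟩
  intro t
  constructor
  · obtain ⟨δ, hδ, hb⟩ := rightVersion_spec hTm e h t
    rw [eventually_nhdsWithin_iff, Metric.eventually_nhds_iff]
    refine ⟨δ, hδ, fun s hs hts => ?_⟩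
    have hts' : (t : ℝ) < s := hts
    rw [Subtype.dist_eq, Real.dist_eq, abs_of_pos (by linarith)] at hs
    obtain ⟨δ', hδ', hb'⟩ := rightVersion_spec hTm e h s
    obtain ⟨q, hq1, hq2⟩ := exists_rat_btwn (show (s : ℝ) < min (s + δ') (t + δ) from
      lt_min (by linarith) (by linarith))
    rw [← hb' q hq1 (hq2.trans_le (min_le_left _ _)),
      hb q (hts'.trans hq1) (hq2.trans_le (min_le_right _ _))]
  · have : Nonempty E := ⟨e⟩
    obtain ⟨a, δ, hδ, hb⟩ := exists_left_value h (t.2.2.trans hTm.le)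
    refine ⟨a, ?_⟩
    rw [eventually_nhdsWithin_iff, Metric.eventually_nhds_iff]
    refine ⟨δ, hδ, fun s hs hst => ?_⟩
    have hst' : (s : ℝ) < t := hst
    rw [Subtype.dist_eq, Real.dist_eq, abs_of_neg (by linarith)] at hs
    obtain ⟨δ', hδ', hb'⟩ := rightVersion_spec hTm e h s
    obtain ⟨q, hq1, hq2⟩ := exists_rat_btwn (show (s : ℝ) < min (s + δ') t from
      lt_min (by linarith) (by linarith))
    have hq0 : (0 : ℝ) ≤ q := s.2.1.trans hq1.le
    rw [← hb' q hq1 (hq2.trans_le (min_le_left _ _)),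
      hb q (by exact_mod_cast hq0) (by linarith) (hq2.trans_le (min_le_right _ _))]

/-- The right-continuous version as an element of the path space. -/
noncomputable def rightPath (hTm : T < m) (e : E) (ω : ℚ → E) : PathSpace E T :=
  ⟨rightVersion hTm e ω, isCadlag_rightVersion hTm e ω⟩

/-- Rational times that decrease to `t`. -/
noncomputable def rationalAbove (n : ℕ) (t : ℝ) : ℚ := ((⌊t * (n + 1)⌋₊ : ℚ) + 1) / (n + 1)

lemma coe_rationalAbove (n : ℕ) (t : ℝ) :
    (rationalAbove n t : ℝ) = ((⌊t * (n + 1)⌋₊ : ℝ) + 1) / (n + 1) := by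
  simp [rationalAbove]

lemma lt_rationalAbove (n : ℕ) (t : ℝ) : t < rationalAbove n t := by
  rw [coe_rationalAbove, lt_div_iff₀ (by positivity)]
  exact Nat.lt_floor_add_one _

lemma rationalAbove_le (n : ℕ) {t : ℝ} (ht : 0 ≤ t) :
    (rationalAbove n t : ℝ) ≤ t + 1 / ((n : ℝ) + 1) := by
  have hn : (0 : ℝ) < n + 1 := by positivity
  rw [coe_rationalAbove, div_le_iff₀ hn, add_mul, one_div_mul_cancel hn.ne']
  linarith [Nat.floor_le (show 0 ≤ t * ((n : ℝ) + 1) by positivity)]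

lemma rationalAbove_mono (n : ℕ) : Monotone (rationalAbove n) := by
  intro s t hst
  unfold rationalAbove
  have h : ⌊s * (n + 1)⌋₊ ≤ ⌊t * (n + 1)⌋₊ :=
    Nat.floor_mono (mul_le_mul_of_nonneg_right hst (by positivity))
  have h' : (⌊s * (n + 1)⌋₊ : ℚ) ≤ ⌊t * (n + 1)⌋₊ := by exact_mod_cast h
  gcongr

lemma rationalAbove_nonneg (n : ℕ) (t : ℝ) : 0 ≤ rationalAbove n t := by
  unfold rationalAbove; positivity

lemma tendsto_rationalAbove {t : ℝ} (ht : 0 ≤ t) :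
    Tendsto (fun n => (rationalAbove n t : ℝ)) atTop (𝓝 t) := by
  have h := (tendsto_one_div_add_atTop_nhds_zero_nat (𝕜 := ℝ)).const_add t
  rw [add_zero] at h
  exact tendsto_of_tendsto_of_tendsto_of_le_of_le tendsto_const_nhds h
    (fun n => (lt_rationalAbove n t).le) fun n => rationalAbove_le n ht

lemma eventually_rationalAbove (hTm : T < m) (e : E) {ω : ℚ → E} (h : ω ∈ regularSet E m)
    (t : Set.Icc (0 : ℝ) T) :
    ∀ᶠ n in atTop, ω (rationalAbove n t) = rightVersion hTm e ω t := by
  obtain ⟨δ, hδ, hb⟩ := rightVersion_spec hTm e h t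
  have hlim := tendsto_rationalAbove t.2.1
  filter_upwards [hlim.eventually_lt_const (show (t : ℝ) < t + δ by linarith)] with n hn
  exact hb _ (lt_rationalAbove n t) hn

/-- Coordinates generate the σ-algebra, and on the regular set each is a pointwise limit of
evaluations at fixed rational times. -/
lemma measurable_rightPath [MeasurableSpace E] [MeasurableSingletonClass E] (hTm : T < m)
    (e : E) : Measurable (rightPath (E := E) hTm e) := by
  classical
  refine measurable_iff_comap_le.2 ?_
  change MeasurableSpace.comap _ (⨆ t : Set.Icc (0 : ℝ) T, _) ≤ _
  rw [MeasurableSpace.comap_iSup]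
  refine iSup_le fun t => ?_
  rw [MeasurableSpace.comap_comp]
  rintro _ ⟨S, -, rfl⟩
  let _ : TopologicalSpace E := ⊥
  have : DiscreteTopology E := ⟨rfl⟩
  have : BorelSpace E := ⟨by
    rw [borel_eq_top_of_discrete]
    exact eq_top_iff.2 fun s _ => (Set.toFinite s).measurableSet⟩
  have hmeas : Measurable fun ω : ℚ → E => rightVersion hTm e ω t := by
    refine measurable_of_tendsto_metrizable (f := fun n ω =>
      if ω ∈ regularSet E m then ω (rationalAbove n t) else e)
      (fun n => Measurable.ite (measurableSet_regularSet m) (measurable_pi_apply _)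
        measurable_const) (tendsto_pi_nhds.2 fun ω => ?_)
    by_cases h : ω ∈ regularSet E m
    · simp only [h, if_true]
      exact tendsto_const_nhds.congr'
        ((eventually_rationalAbove hTm e h t).mono fun n hn => hn.symm)
    · simp only [h, if_false, rightVersion, dif_neg, not_false_eq_true]
      exact tendsto_const_nhds
  exact hmeas (Set.toFinite S).measurableSet

end Regularization

/-- The continuous-time Markov chain exists as a law on the path space. -/
theorem exists_isMarkovLaw {E : Type*} [Fintype E] [DecidableEq E] {r : E → E → ℝ}
    (hr : ∀ a b, a ≠ b → 0 ≤ r a b) {μ : E → ℝ} (hμ : μ ∈ stdSimplex ℝ E) (T : ℝ) :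
    ∃ P : Measure (PathSpace E T), IsMarkovLaw r μ T P := by
  obtain ⟨e⟩ : Nonempty E := by
    by_contra h
    have := not_nonempty_iff.1 h
    simpa using hμ.2
  let _ : TopologicalSpace E := ⊥
  have : DiscreteTopology E := ⟨rfl⟩
  let _ : MeasurableSpace E := ⊤
  have : BorelSpace E := ⟨borel_eq_top_of_discrete.symm⟩
  obtain ⟨Q, hQ1, hQ⟩ := exists_rationalLaw (E := E) hr hμ
  -- Strictness leaves controlled rational times to the right of `T`.
  obtain ⟨m, hTm⟩ := exists_nat_gt T
  have hmeas := measurable_rightPath (E := E) hTm e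
  refine ⟨Q.map _, Measure.isProbabilityMeasure_map hmeas.aemeasurable, fun k t x ht ht0 => ?_⟩
  have hset : MeasurableSet {ω : PathSpace E T | ∀ i, ω.1 (t i) = x i} := by
    have : {ω : PathSpace E T | ∀ i, ω.1 (t i) = x i}
        = ⋂ i, {ω | ω.1 (t i) ∈ ({x i} : Set E)} := by
      ext; simp
    rw [this]
    exact MeasurableSet.iInter fun i => measurableSet_coord _ _
  rw [Measure.map_apply hmeas hset]
  have hm1 : ∀ n, MeasurableSet {ω : ℚ → E | ∀ i, ω (rationalAbove n (t i)) = x i} := by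
    intro n
    have : {ω : ℚ → E | ∀ i, ω (rationalAbove n (t i)) = x i}
        = ⋂ i, {ω | ω (rationalAbove n (t i)) = x i} := by
      ext; simp
    rw [this]
    exact MeasurableSet.iInter fun i =>
      measurableSet_eq_fun (measurable_pi_apply _) measurable_const
  have hlim := tendsto_measure_of_ae_tendsto_indicator_of_isFiniteMeasure atTop (μ := Q)
    (hmeas hset) hm1 (by
      filter_upwards [hQ.ae_mem_regularSet hr hμ m] with ω hω
      have hall : ∀ᶠ n in atTop, ∀ i, ω (rationalAbove n (t i)) = rightVersion hTm e ω (t i) :=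
        eventually_all.2 fun i => eventually_rationalAbove hTm e hω (t i)
      filter_upwards [hall] with n hn
      change (∀ i, ω (rationalAbove n (t i)) = x i) ↔ ∀ i, rightVersion hTm e ω (t i) = x i
      simp only [hn])
  have hrat : ∀ n, Q {ω : ℚ → E | ∀ i, ω (rationalAbove n (t i)) = x i} = _ := fun n =>
    hQ k (fun i => rationalAbove n (t i)) (fun i j hij => rationalAbove_mono n (ht hij))
      (rationalAbove_nonneg n _) x
  simp only [hrat] at hlim
  refine tendsto_nhds_unique hlim (ENNReal.tendsto_ofReal (Tendsto.mul ?_ ?_))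
  -- The first rational time is positive although `t 0 = 0`, so the initial weight is only reached
  -- in the limit, by continuity of the marginal.
  · have h1 : Continuous fun s : ℝ => (μ ᵥ* transition r s) (x 0) := by
      simp only [Matrix.vecMul, dotProduct]
      exact continuous_finsetSum _ fun c _ =>
        continuous_const.mul (continuous_transition_apply r c (x 0))
    have h2 := (h1.tendsto _).comp (tendsto_rationalAbove (t 0).2.1)
    have h3 : (μ ᵥ* transition r (t 0)) (x 0) = μ (x 0) := by rw [ht0]; simp
    rwa [h3] at h2
  · refine tendsto_finsetProd _ fun i _ => ?_
    exact ((continuous_transition_apply r _ _).tendsto _).comp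
      ((tendsto_rationalAbove (t i.succ).2.1).sub (tendsto_rationalAbove (t i.castSucc).2.1))

end FiniteChain

/-! ### Assembly of the theorem. -/

theorem mainTheorem2 {E : Type*} [Fintype E] [DecidableEq E]
    (r : E → E → ℝ) (hr : ∀ a b, a ≠ b → 0 ≤ r a b)
    (μ : E → ℝ) (hμ : μ ∈ stdSimplex ℝ E) :
    -- the Hamiltonian of the empirical distribution
    (∀ f : E → ℝ,
      Tendsto (fun p : (Σ N : ℕ, (Fin N → E)) => FiniteChain.preHamiltonian r f p.2)
        (FiniteChain.configFilter μ) (𝓝 (FiniteChain.hamiltonian r μ f))) ∧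
    -- the supremum is realized in the irreducible case
    ((∀ a, 0 < μ a) → FiniteChain.Irreducible r → ∀ α : E → ℝ, ∑ a, α a = 0 →
      ∃ f, FiniteChain.RealizesSup r μ α f) ∧
    -- the path space measures exist and are determined by the rates and the initial distribution
    (∀ q : E → E → ℝ, (∀ a b, a ≠ b → 0 ≤ q a b) → ∀ T : ℝ, 0 < T →
      ∃! P : Measure (FiniteChain.PathSpace E T), FiniteChain.IsMarkovLaw q μ T P) ∧
    -- the equation for the optimal function
    (∀ α f : E → ℝ, FiniteChain.RealizesSup r μ α f ↔
      ∀ b, α b = ∑ a, (μ a * r a b * Real.exp (f b - f a) - μ b * r b a * Real.exp (f a - f b))) ∧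
    ∀ α f : E → ℝ, FiniteChain.RealizesSup r μ α f →
      ∀ rs : E → E → ℝ, rs = FiniteChain.modifiedRates r f →
      -- the modified rates produce the velocity `α` from `μ`
      (∀ b, α b = ∑ a, (μ a * rs a b - μ b * rs b a)) ∧
      HasDerivAt (fun t : ℝ => μ ᵥ* FiniteChain.transition rs t) α 0 ∧
      -- the Lagrangian in terms of the optimal function and of the modified rates
      FiniteChain.lagrangian r μ α =
        ((∑ a, ∑ b, μ b * r b a * (f a * Real.exp (f a - f b) - f b * Real.exp (f a - f b)
          - (Real.exp (f a - f b) - 1)) : ℝ) : EReal) ∧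
      FiniteChain.lagrangian r μ α =
        ((∑ a, ∑ b, μ b * rs b a * Real.log (rs b a / r b a)
          - ∑ a, ∑ b, μ b * (rs b a - r b a) : ℝ) : EReal) ∧
      -- the path space measures with rates `r*` and `r`, both started from `μ`
      ∀ Ps P : ∀ T : ℝ, Measure (FiniteChain.PathSpace E T),
        (∀ T, 0 < T → FiniteChain.IsMarkovLaw rs μ T (Ps T)) →
        (∀ T, 0 < T → FiniteChain.IsMarkovLaw r μ T (P T)) →
        -- Radon-Nikodym derivative
        (∀ T, 0 < T → Ps T ≪ P T ∧ (Ps T).rnDeriv (P T) =ᵐ[P T] fun ω =>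
          ENNReal.ofReal (Real.exp (∑ a, ∑ b,
            (Real.log (rs b a / r b a) * (FiniteChain.jumpCount b a ω : ℝ)
              - (rs b a - r b a) * FiniteChain.occupationTime b ω)))) ∧
        -- the Lagrangian as relative entropy production
        (∀ T, 0 < T → InformationTheory.klDiv (Ps T) (P T) ≠ ∞) ∧
        Tendsto (fun T : ℝ =>
            ((InformationTheory.klDiv (Ps T) (P T) / ENNReal.ofReal T : ℝ≥0∞) : EReal))
          (𝓝[>] 0) (𝓝 (FiniteChain.lagrangian r μ α)) ∧
        (fun T : ℝ => (InformationTheory.klDiv (Ps T) (P T)).toReal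
            - T * (FiniteChain.lagrangian r μ α).toReal) =O[𝓝[>] 0] fun T : ℝ => T ^ 2 := by

  have hE : Nonempty E := by
    by_contra h
    have := not_nonempty_iff.1 h
    simpa using hμ.2
  refine ⟨FiniteChain.tendsto_preHamiltonian r μ,
    fun hμ0 hirr α hα => FiniteChain.exists_realizesSup hr hμ0 hirr hα,
    fun q hq T hT => ?_, FiniteChain.realizesSup_iff hr hμ.1, ?_⟩
  · obtain ⟨P, hP⟩ := FiniteChain.exists_isMarkovLaw hq hμ T
    exact ⟨P, hP, fun P' hP' => hP.unique hq hμ hT hP'⟩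
  rintro α f hf _ rfl
  have heq := (FiniteChain.realizesSup_iff hr hμ.1 α f).1 hf
  have hvel := FiniteChain.modifiedRates_velocity heq
  have hL := hf
  unfold FiniteChain.RealizesSup at hL
  refine ⟨hvel, FiniteChain.hasDerivAt_vecMul_transition hvel, ?_, ?_, ?_⟩
  · rw [hL, FiniteChain.lagrangian_value heq]
  · rw [hL, FiniteChain.lagrangian_value_entropy heq]
  intro Ps P hPs hP
  obtain ⟨C, δ, -, hδ, hb⟩ := FiniteChain.exists_abs_klDiv_sub_le hr hμ hvel hPs hP
  set ℓ : ℝ := ∑ a, f a * α a - FiniteChain.hamiltonian r μ f with hℓ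
  have hfin : ∀ T, 0 < T → InformationTheory.klDiv (Ps T) (P T) ≠ ∞ :=
    fun T hT => (hP T hT).klDiv_ne_top hr hμ hT (hPs T hT)
  have hO : (fun T : ℝ => (InformationTheory.klDiv (Ps T) (P T)).toReal - T * ℓ)
      =O[𝓝[>] 0] fun T : ℝ => T ^ 2 := by
    refine Asymptotics.IsBigO.of_bound C ?_
    filter_upwards [Ioc_mem_nhdsGT hδ] with T hT
    rw [Real.norm_eq_abs, Real.norm_eq_abs, abs_of_nonneg (sq_nonneg T)]
    exact hb T hT.1 hT.2
  -- Comparison with the test function `0`. Nonnegativity is needed because the entropy quotient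
  -- converges in `ℝ≥0∞` before it is mapped to `EReal`.
  have hℓ0 : 0 ≤ ℓ := by
    have := FiniteChain.realizesSup_iff_forall_le.1 hf 0
    have e : FiniteChain.hamiltonian r μ 0 = 0 := by simp [FiniteChain.hamiltonian]
    rw [e] at this
    simpa only [Pi.zero_apply, zero_mul, Finset.sum_const_zero, sub_zero] using this
  refine ⟨fun T hT => ⟨(hP T hT).absolutelyContinuous hr hμ hT (hPs T hT), ?_⟩, hfin, ?_, ?_⟩
  · filter_upwards [(hP T hT).rnDeriv_eq hr hμ hT (hPs T hT),
      (hP T hT).ae_density_eq hr hμ hT f] with ω h1 h2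
    rw [h1, h2]
  · have hlim : Tendsto (fun T : ℝ => (InformationTheory.klDiv (Ps T) (P T)).toReal / T)
        (𝓝[>] 0) (𝓝 ℓ) := by
      have h1 : (fun T : ℝ => T ^ 2) =o[𝓝[>] 0] fun T : ℝ => T := by
        refine ((Asymptotics.isLittleO_pow_id one_lt_two).mono nhdsWithin_le_nhds)
      have h2 := (hO.trans_isLittleO h1).tendsto_div_nhds_zero.add_const ℓ
      rw [zero_add] at h2
      refine h2.congr' ?_
      filter_upwards [self_mem_nhdsWithin] with T hT
      have hT' : T ≠ 0 := (Set.mem_Ioi.1 hT).ne'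
      field_simp
      ring
    rw [hL]
    have h3 := (continuous_coe_ennreal_ereal.tendsto _).comp (ENNReal.tendsto_ofReal hlim)
    rw [EReal.coe_ennreal_ofReal, max_eq_left hℓ0] at h3
    refine h3.congr' ?_
    filter_upwards [self_mem_nhdsWithin] with T hT
    rw [Function.comp_apply, ENNReal.ofReal_div_of_pos hT, ENNReal.ofReal_toReal (hfin T hT)]
  · rw [hL, EReal.toReal_coe]
    exact hO
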